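/- Theorem 1. Let $n\ge 3$ and let $Q_{2n}$ be the real nilpotent Lie algebra with basis $X_1,\dots,X_{2n}$ and nonzero brackets $[X_1,X_k]=X_{k+1}$ $(2\le k\le 2n-2)$ and $[X_k,X_{2n+1-k}]=(-1)^kX_{2n}$ $(2\le k\le n)$. For a real Lie algebra $\mathfrak g$ with basis $(Z_i)$, $[Z_i,Z_j]=\sum_k C_{ij}^kZ_k$, and coordinates $(x_i)$ on $\mathfrak g^*$, a generalized Casimir invariant on an open set $U$ is a smooth solution $F$ on $U$ of the system $-\sum_{j,k}C_{ij}^kx_k\,\partial F/\partial x_j=0$ for all $i$. A fundamental set of invariants on $U$ is a maximal family of functionally independent invariants: their differentials are linearly independent on a dense subset of $U$, and no invariant defined on a nonempty open subset of $U$ can be added to the family there. We say that $\mathfrak g$ has exactly $m$ generalized Casimir invariants if every nonempty open set contains a nonempty open set on which a fundamental set of $m$ invariants exists, and every fundamental set of invariants on any nonempty open set has $m$ elements. Every solvable real Lie algebra of dimension $2n+1$ whose nilradical (greatest nilpotent ideal) is isomorphic to $Q_{2n}$ has exactly one generalized Casimir invariant. In particular this holds for the following algebras with basis $X_1,\dots,X_{2n},Y$,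 whose nonzero brackets are those of $Q_{2n}$ and the indicated brackets with $Y$. With coordinates $(x_1,\dots,x_{2n},y)$ and $$I_2=x_1x_{2n}+x_3x_{2n-1}+\sum_{k=4}^{n}(-1)^{k+1}x_kx_{2n+2-k}+\frac{(-1)^n}{2}x_{n+1}^2,$$ the single function $J$ given below is a fundamental set of invariants on the indicated open set. 1. $\mathfrak r_{2n+1}(\lambda_2)$, $\lambda_2\in\mathbb R$: $[Y,X_1]=X_1$, $[Y,X_k]=(k-2+\lambda_2)X_k$ $(2\le k\le 2n-1)$, $[Y,X_{2n}]=(2n-3+2\lambda_2)X_{2n}$. If $2n-3+2\lambda_2\neq0$, then $J=I_2\,x_{2n}^{-\alpha}$ with $\alpha=\frac{2n-2+2\lambda_2}{2n-3+2\lambda_2}$, on $\{x_{2n}>0\}$; if $2n-3+2\lambda_2=0$, then $J=x_{2n}$, on the whole space. 2. $\mathfrak r_{2n+1}(2-n,\varepsilon)$, $\varepsilon\in\{-1,0,1\}$: $[Y,X_1]=X_1+\varepsilon X_{2n}$, $[Y,X_k]=(k-n)X_k$ $(2\le k\le 2n-1)$, $[Y,X_{2n}]=X_{2n}$. Here $J=\dfrac{I_2}{x_{2n}^2}-\varepsilon\ln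 x_{2n}$, on $\{x_{2n}>0\}$. 3. $\mathfrak r_{2n+1}(\lambda_2^5,\lambda_2^7,\dots,\lambda_2^{2n-1})$, with arbitrary real parameters: $[Y,X_{2+t}]=X_{2+t}+\sum_{k\ge2,\ 2k+1+t\le 2n-1}\lambda_2^{2k+1}X_{2k+1+t}$ $(0\le t\le 2n-3)$, $[Y,X_{2n}]=2X_{2n}$. Here $J=\dfrac{I_2}{x_{2n}}$, on $\{x_{2n}\neq0\}$. -/

import Mathlib

open scoped ContDiff

noncomputable section

namespace SolvableQ

/-! ## Invariants of the coadjoint representation -/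

section Invariants

variable {ι L : Type*} [Fintype ι] [DecidableEq ι] [LieRing L] [LieAlgebra ℝ L]

/-- The first order differential operator `X̂ᵢ = - Cᵢⱼᵏ xₖ ∂/∂xⱼ` attached to the `i`-th vector of a
basis `b` of `L`, where `[bᵢ, bⱼ] = Cᵢⱼᵏ bₖ`; here `x : ι → ℝ` are the linear coordinates on the
dual of `L` given by `b`. -/
def coadjointOp (b : Module.Basis ι ℝ L) (i : ι) (F : (ι → ℝ) → ℝ) (x : ι → ℝ) : ℝ :=
  -∑ j, ∑ k, b.repr ⁅b i, b j⁆ k * x k * fderiv ℝ F x (Pi.single j 1)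

/-- `F` is an invariant (generalized Casimir invariant) on the set `U`: it is smooth on `U` and
solves the system `X̂ᵢ F = 0` for all `i` there. Only used for open `U`. -/
def IsInvariantOn (b : Module.Basis ι ℝ L) (U : Set (ι → ℝ)) (F : (ι → ℝ) → ℝ) : Prop :=
  ContDiffOn ℝ ∞ F U ∧ ∀ i, ∀ x ∈ U, coadjointOp b i F x = 0

/-- Functional independence of `F₁, …, Fₘ` on the open set `U` (Jacobian criterion): the
differentials are linearly independent on a dense subset of `U`, that is, the functions are
functionally dependent on no nonempty open subset of `U`. -/
def FunctionallyIndependentOn {m : ℕ} (U : Set (ι → ℝ)) (F : Fin m → (ι → ℝ) → ℝ) : Prop :=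
  ∀ V ⊆ U, IsOpen V → V.Nonempty → ∃ x ∈ V, LinearIndependent ℝ fun a => fderiv ℝ (F a) x

/-- `F₁, …, Fₘ` is a fundamental set of invariants on the open set `U`: a maximal family of
functionally independent invariants. Maximality is required locally as well: no invariant, even if
defined only on a nonempty open part `V` of `U`, can be added to the family. -/
def IsFundamentalOn {m : ℕ} (b : Module.Basis ι ℝ L) (U : Set (ι → ℝ))
    (F : Fin m → (ι → ℝ) → ℝ) : Prop :=
  (∀ a, IsInvariantOn b U (F a)) ∧ FunctionallyIndependentOn U F ∧
    ∀ V ⊆ U, IsOpen V → V.Nonempty → ∀ G : (ι → ℝ) → ℝ, IsInvariantOn b V G →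
      ¬ FunctionallyIndependentOn V (Fin.cons G F : Fin (m + 1) → (ι → ℝ) → ℝ)

/-- `L` has exactly `m` (functionally independent) generalized Casimir invariants: fundamental sets
of `m` invariants exist locally near a dense set of points, and every fundamental set of invariants,
on any nonempty open set, has `m` elements. -/
def HasExactlyInvariants (b : Module.Basis ι ℝ L) (m : ℕ) : Prop :=
  ∀ U : Set (ι → ℝ), IsOpen U → U.Nonempty →
    (∃ V ⊆ U, IsOpen V ∧ V.Nonempty ∧ ∃ F : Fin m → (ι → ℝ) → ℝ, IsFundamentalOn b V F) ∧
    ∀ (p : ℕ) (F : Fin p → (ι → ℝ) → ℝ), IsFundamentalOn b U F → p = m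

/-- `N` is the nilradical of `L`: its greatest nilpotent ideal (nilpotent as a Lie algebra). -/
def IsNilradical (N : LieIdeal ℝ L) : Prop :=
  IsGreatest {I : LieIdeal ℝ L | LieRing.IsNilpotent I} N

end Invariants

/-! ## The nilpotent Lie algebra `Q₂ₙ` -/

/-- The indices `1, …, 2n` of the basis `X₁, …, X₂ₙ`. -/
abbrev Idx (n : ℕ) : Type := ↥(Finset.Icc 1 (2 * n))

/-- The underlying vector space of `Q₂ₙ`: coordinate vectors `u₁ X₁ + … + u₂ₙ X₂ₙ`. -/
def Q (n : ℕ) : Type := Idx n → ℝ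

instance (n : ℕ) : AddCommGroup (Q n) := inferInstanceAs (AddCommGroup (Idx n → ℝ))
instance (n : ℕ) : Module ℝ (Q n) := inferInstanceAs (Module ℝ (Idx n → ℝ))

/-- The `k`-th coordinate, `1 ≤ k ≤ 2n`, of a vector (and `0` for other `k`). -/
def co {n : ℕ} (u : Q n) (k : ℕ) : ℝ :=
  if h : k ∈ Finset.Icc 1 (2 * n) then u ⟨k, h⟩ else 0

/-- The vector with coordinates `f 1, …, f (2n)`. -/
def ofCo {n : ℕ} (f : ℕ → ℝ) : Q n := fun k : Idx n => f k

/-- The alternating form `∑_{j=2}^{2n-1} (-1)ʲ uⱼ v_{2n+1-j}`. -/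
def form (n : ℕ) (u v : ℕ → ℝ) : ℝ :=
  ∑ j ∈ Finset.Icc 2 (2 * n - 1), (-1) ^ j * u j * v (2 * n + 1 - j)

/-- The bracket of `Q₂ₙ`: the bilinear alternating map with
`[X₁, Xₖ] = Xₖ₊₁` for `2 ≤ k ≤ 2n-2` and `[Xₖ, X_{2n+1-k}] = (-1)ᵏ X₂ₙ` for `2 ≤ k ≤ n`,
the other brackets `[Xᵢ, Xⱼ]`, `i < j`, being zero. -/
instance (n : ℕ) : Bracket (Q n) (Q n) where
  bracket u v := ofCo fun k =>
    if k = 2 * n then form n (co u) (co v)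
    else if 3 ≤ k then co u 1 * co v (k - 1) - co u (k - 1) * co v 1
    else 0

/-- The shift of the coordinates `2, 3, …` by `s`. -/
def shift (s : ℕ) (f : ℕ → ℝ) (m : ℕ) : ℝ := if s + 2 ≤ m then f (m - s) else 0

lemma co_apply {n : ℕ} (u : Q n) (k : Idx n) : co u k = u k := by
  simp only [co, dif_pos k.2]

lemma co_ofCo {n : ℕ} (f : ℕ → ℝ) (k : ℕ) (h1 : 1 ≤ k) (h2 : k ≤ 2 * n) :
    co (ofCo f : Q n) k = f k := by
  rw [co, dif_pos (Finset.mem_Icc.2 ⟨h1, h2⟩)]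
  rfl

lemma co_add {n : ℕ} (u v : Q n) (k : ℕ) : co (u + v) k = co u k + co v k := by
  unfold co; split_ifs
  · rfl
  · simp

lemma co_smul {n : ℕ} (t : ℝ) (u : Q n) (k : ℕ) : co (t • u) k = t * co u k := by
  unfold co; split_ifs
  · rfl
  · simp

lemma ext_co {n : ℕ} {u v : Q n} (h : ∀ k, 1 ≤ k → k ≤ 2 * n → co u k = co v k) : u = v := by
  funext k
  have hk := Finset.mem_Icc.1 k.2
  have := h k hk.1 hk.2
  rwa [co_apply, co_apply] at this

lemma co_lie {n : ℕ} (u v : Q n) (k : ℕ) (h1 : 1 ≤ k) (h2 : k ≤ 2 * n) :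
    co ⁅u, v⁆ k = if k = 2 * n then form n (co u) (co v)
      else if 3 ≤ k then co u 1 * co v (k - 1) - co u (k - 1) * co v 1 else 0 :=
  co_ofCo _ k h1 h2

lemma form_comm (n : ℕ) (u v : ℕ → ℝ) : form n u v = -form n v u := by
  unfold form
  rw [← Finset.sum_neg_distrib]
  refine Finset.sum_nbij' (fun j => 2 * n + 1 - j) (fun j => 2 * n + 1 - j) ?_ ?_ ?_ ?_ ?_
  · intro j hj; rw [Finset.mem_Icc] at *; omega
  · intro j hj; rw [Finset.mem_Icc] at *; omega
  · intro j hj; rw [Finset.mem_Icc] at *; omega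
  · intro j hj; rw [Finset.mem_Icc] at *; omega
  · intro j hj
    rw [Finset.mem_Icc] at hj
    have e : 2 * n + 1 - (2 * n + 1 - j) = j := by omega
    have hs : (-1 : ℝ) ^ (2 * n + 1 - j) = -(-1) ^ j := by
      have : (-1 : ℝ) ^ (2 * n + 1 - j) * (-1) ^ j = -1 := by
        rw [← pow_add, Nat.sub_add_cancel (by omega), pow_succ, pow_mul]; norm_num
      have h2 : (-1 : ℝ) ^ j * (-1) ^ j = 1 := by rw [← mul_pow]; norm_num
      linear_combination (-1 : ℝ) ^ j * this - (-1 : ℝ) ^ (2 * n + 1 - j) * h2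
    simp only [e, hs]; ring

lemma form_shift (n s : ℕ) (u v : ℕ → ℝ) :
    form n (shift s u) v = (-1) ^ s * form n u (shift s v) := by
  unfold form shift
  rw [Finset.mul_sum]
  simp only [mul_ite, ite_mul, mul_zero, zero_mul]
  rw [← Finset.sum_filter, ← Finset.sum_filter]
  refine Finset.sum_nbij' (fun j => j - s) (fun j => j + s) ?_ ?_ ?_ ?_ ?_
  · intro j hj; rw [Finset.mem_filter, Finset.mem_Icc] at *; omega
  · intro j hj; rw [Finset.mem_filter, Finset.mem_Icc] at *; omega
  · intro j hj; rw [Finset.mem_filter, Finset.mem_Icc] at *; omega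
  · intro j hj; rw [Finset.mem_filter, Finset.mem_Icc] at *; omega
  · intro j hj
    rw [Finset.mem_filter, Finset.mem_Icc] at hj
    have e : 2 * n + 1 - (j - s) - s = 2 * n + 1 - j := by omega
    have hs : (-1 : ℝ) ^ j = (-1) ^ s * (-1) ^ (j - s) := by
      rw [← pow_add]; congr 1; omega
    rw [e, hs]; ring

lemma form_congr {n : ℕ} {u u' v v' : ℕ → ℝ}
    (hu : ∀ j, 2 ≤ j → j ≤ 2 * n - 1 → u j = u' j) (hv : ∀ j, 2 ≤ j → j ≤ 2 * n - 1 → v j = v' j) :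
    form n u v = form n u' v' := by
  unfold form
  refine Finset.sum_congr rfl fun j hj => ?_
  rw [Finset.mem_Icc] at hj
  rw [hu j hj.1 hj.2, hv _ (by omega) (by omega)]

lemma form_add_left (n : ℕ) (u u' v : ℕ → ℝ) :
    form n (fun k => u k + u' k) v = form n u v + form n u' v := by
  unfold form; rw [← Finset.sum_add_distrib]; exact Finset.sum_congr rfl fun j _ => by ring

lemma form_smul_left (n : ℕ) (t : ℝ) (u v : ℕ → ℝ) :
    form n (fun k => t * u k) v = t * form n u v := by
  unfold form; rw [Finset.mul_sum]; exact Finset.sum_congr rfl fun j _ => by ring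

lemma form_add_right (n : ℕ) (u v v' : ℕ → ℝ) :
    form n u (fun k => v k + v' k) = form n u v + form n u v' := by
  unfold form; rw [← Finset.sum_add_distrib]; exact Finset.sum_congr rfl fun j _ => by ring

lemma form_smul_right (n : ℕ) (t : ℝ) (u v : ℕ → ℝ) :
    form n u (fun k => t * v k) = t * form n u v := by
  unfold form; rw [Finset.mul_sum]; exact Finset.sum_congr rfl fun j _ => by ring

lemma form_lie_right {n : ℕ} (f : ℕ → ℝ) (v w : Q n) :
    form n f (co ⁅v, w⁆) = co v 1 * form n f (shift 1 (co w))
      - co w 1 * form n f (shift 1 (co v)) := by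
  have : form n f (co ⁅v, w⁆) = form n f
      (fun k => co v 1 * shift 1 (co w) k + (-co w 1) * shift 1 (co v) k) := by
    refine form_congr (fun _ _ _ => rfl) fun j h2 h3 => ?_
    rw [co_lie v w j (by omega) (by omega), if_neg (by omega)]
    unfold shift
    by_cases h : 3 ≤ j
    · rw [if_pos h, if_pos (by omega), if_pos (by omega)]; ring
    · rw [if_neg h, if_neg (by omega), if_neg (by omega)]; ring
  rw [this, form_add_right, form_smul_right, form_smul_right]; ring

lemma co_zero {n : ℕ} (k : ℕ) : co (0 : Q n) k = 0 := by
  unfold co; split_ifs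
  · rfl
  · rfl

lemma co_lie_one {n : ℕ} (u v : Q n) (h : 1 ≤ n) : co ⁅u, v⁆ 1 = 0 := by
  rw [co_lie u v 1 le_rfl (by omega), if_neg (by omega), if_neg (by omega)]

instance (n : ℕ) : LieRing (Q n) where
  add_lie x y z := ext_co fun k h1 h2 => by
    have e : co (x + y) = fun k => co x k + co y k := funext (co_add x y)
    simp only [co_add, co_lie _ _ k h1 h2, e, form_add_left]
    split_ifs <;> ring
  lie_add x y z := ext_co fun k h1 h2 => by
    have e : co (y + z) = fun k => co y k + co z k := funext (co_add y z)
    simp only [co_add, co_lie _ _ k h1 h2, e, form_add_right]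
    split_ifs <;> ring
  lie_self x := ext_co fun k h1 h2 => by
    rw [co_lie x x k h1 h2, co_zero]
    have := form_comm n (co x) (co x)
    split_ifs
    · linarith
    · ring
    · rfl
  leibniz_lie x y z := ext_co fun k h1 h2 => by
    have hn : 1 ≤ n := by omega
    rw [co_add, co_lie _ _ k h1 h2, co_lie _ _ k h1 h2, co_lie _ _ k h1 h2,
      co_lie_one _ _ hn, co_lie_one _ _ hn, co_lie_one _ _ hn]
    split_ifs with h3 h4
    · have sym : ∀ f g : ℕ → ℝ, form n f (shift 1 g) = form n g (shift 1 f) := fun f g => by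
        rw [form_comm n g, form_shift]; ring
      rw [form_comm n (co ⁅x, y⁆), form_lie_right, form_lie_right, form_lie_right,
        sym (co z) (co y), sym (co z) (co x), sym (co y) (co x)]
      ring
    · have key : ∀ p q : Q n, co ⁅p, q⁆ (k - 1) =
          if 3 ≤ k - 1 then co p 1 * co q (k - 1 - 1) - co p (k - 1 - 1) * co q 1 else 0 :=
        fun p q => by rw [co_lie _ _ (k - 1) (by omega) (by omega), if_neg (by omega)]
      rw [key, key, key]
      split_ifs
      · ring
      · ring
    · ring

instance (n : ℕ) : LieAlgebra ℝ (Q n) where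
  lie_smul t x y := ext_co fun k h1 h2 => by
    have e : co (t • y) = fun k => t * co y k := funext (co_smul t y)
    simp only [co_smul, co_lie _ _ k h1 h2, e, form_smul_right]
    split_ifs <;> ring

/-! ## The solvable extensions of dimension `2n + 1` -/

/-- The linear endomorphism of `Q₂ₙ` given by
`X₁ ↦ a X₁ + e X₂ₙ`, `X₂ₙ ↦ ((2n-3) a + 2 d) X₂ₙ` and, for `2 ≤ m ≤ 2n-1`,
`Xₘ ↦ ((m-2) a + d) Xₘ + ∑_{2 ≤ k ≤ n-1, m+2k-1 ≤ 2n-1} c_{2k+1} X_{m+2k-1}`. -/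
def derMap (n : ℕ) (a d e : ℝ) (c : ℕ → ℝ) : Q n →ₗ[ℝ] Q n where
  toFun u := ofCo fun m =>
    if m = 1 then a * co u 1
    else if m = 2 * n then ((2 * n - 3 : ℝ) * a + 2 * d) * co u (2 * n) + e * co u 1
    else ((m - 2 : ℝ) * a + d) * co u m
      + ∑ k ∈ Finset.Icc 2 (n - 1), c (2 * k + 1) * shift (2 * k - 1) (co u) m
  map_add' u v := ext_co fun m h1 h2 => by
    have e : co (u + v) = fun k => co u k + co v k := funext (co_add u v)
    have e2 : ∀ s k, shift s (fun k => co u k + co v k) k = shift s (co u) k + shift s (co v) k :=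
      fun s k => by unfold shift; split_ifs <;> simp
    simp only [co_add, co_ofCo _ m h1 h2, e, e2, mul_add, Finset.sum_add_distrib]
    split_ifs <;> ring
  map_smul' t u := ext_co fun m h1 h2 => by
    have e : co (t • u) = fun k => t * co u k := funext (co_smul t u)
    have e2 : ∀ s k, shift s (fun k => t * co u k) k = t * shift s (co u) k :=
      fun s k => by unfold shift; split_ifs <;> simp
    have e3 : ∀ k : ℕ, ∀ y : ℝ, c k * (t * y) = t * (c k * y) := fun k y => by ring
    simp only [RingHom.id_apply, co_smul, co_ofCo _ m h1 h2, e, e2, e3, ← Finset.mul_sum]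
    split_ifs <;> ring

lemma co_derMap {n : ℕ} (a d e : ℝ) (c : ℕ → ℝ) (u : Q n) (m : ℕ) (h1 : 1 ≤ m) (h2 : m ≤ 2 * n) :
    co (derMap n a d e c u) m =
      if m = 1 then a * co u 1
      else if m = 2 * n then ((2 * n - 3 : ℝ) * a + 2 * d) * co u (2 * n) + e * co u 1
      else ((m - 2 : ℝ) * a + d) * co u m
        + ∑ k ∈ Finset.Icc 2 (n - 1), c (2 * k + 1) * shift (2 * k - 1) (co u) m := by
  simp only [derMap, LinearMap.coe_mk, AddHom.coe_mk]
  rw [co_ofCo _ m h1 h2]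

lemma co_sub {n : ℕ} (u v : Q n) (k : ℕ) : co (u - v) k = co u k - co v k := by
  unfold co; split_ifs
  · rfl
  · simp

lemma form_sum_left (n : ℕ) (s : Finset ℕ) (t : ℕ → ℝ) (f : ℕ → ℕ → ℝ) (v : ℕ → ℝ) :
    form n (fun m => ∑ k ∈ s, t k * f k m) v = ∑ k ∈ s, t k * form n (f k) v := by
  unfold form
  simp only [Finset.mul_sum, Finset.sum_mul]
  rw [Finset.sum_comm]
  exact Finset.sum_congr rfl fun k _ => Finset.sum_congr rfl fun j _ => by ring

lemma form_sum_right (n : ℕ) (s : Finset ℕ) (t : ℕ → ℝ) (f : ℕ → ℕ → ℝ) (v : ℕ → ℝ) :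
    form n v (fun m => ∑ k ∈ s, t k * f k m) = ∑ k ∈ s, t k * form n v (f k) := by
  rw [form_comm, form_sum_left, ← Finset.sum_neg_distrib]
  exact Finset.sum_congr rfl fun k _ => by rw [form_comm n v]; ring

lemma form_diag (n : ℕ) (a d : ℝ) (u v : ℕ → ℝ) :
    form n (fun m => ((m - 2 : ℝ) * a + d) * u m) v + form n u (fun m => ((m - 2 : ℝ) * a + d) * v m)
      = ((2 * n - 3 : ℝ) * a + 2 * d) * form n u v := by
  unfold form
  rw [← Finset.sum_add_distrib, Finset.mul_sum]
  refine Finset.sum_congr rfl fun j hj => ?_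
  rw [Finset.mem_Icc] at hj
  simp only [Nat.cast_sub (by omega : j ≤ 2 * n + 1)]
  push_cast
  ring

lemma derMap_lie (n : ℕ) (a d e : ℝ) (c : ℕ → ℝ) (u v : Q n) :
    derMap n a d e c ⁅u, v⁆ = ⁅u, derMap n a d e c v⁆ - ⁅v, derMap n a d e c u⁆ := by
  refine ext_co fun m h1 h2 => ?_
  have hn : 1 ≤ n := by omega
  have d1 : ∀ w : Q n, co (derMap n a d e c w) 1 = a * co w 1 := fun w => by
    rw [co_derMap _ _ _ _ _ 1 le_rfl (by omega), if_pos rfl]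
  rw [co_sub, co_derMap _ _ _ _ _ m h1 h2, co_lie u (derMap n a d e c v) m h1 h2,
    co_lie v (derMap n a d e c u) m h1 h2, d1, d1]
  by_cases m1 : m = 1
  · subst m1
    rw [if_pos rfl, co_lie_one _ _ hn, if_neg (by omega), if_neg (by omega), if_neg (by omega),
      if_neg (by omega)]
    ring
  rw [if_neg m1]
  by_cases m2 : m = 2 * n
  · rw [if_pos m2, if_pos m2, if_pos m2, co_lie_one _ _ hn, co_lie _ _ (2 * n) (by omega) le_rfl,
      if_pos rfl]
    have hD : ∀ f : ℕ → ℝ, ∀ w : Q n, form n f (co (derMap n a d e c w)) =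
        form n f (fun m => ((m - 2 : ℝ) * a + d) * co w m)
        + ∑ k ∈ Finset.Icc 2 (n - 1), c (2 * k + 1) * form n f (shift (2 * k - 1) (co w)) := by
      intro f w
      rw [← form_sum_right, ← form_add_right]
      refine form_congr (fun _ _ _ => rfl) fun j h2 h3 => ?_
      rw [co_derMap _ _ _ _ _ j (by omega) (by omega), if_neg (by omega), if_neg (by omega)]
    have hs : ∀ k ∈ Finset.Icc 2 (n - 1),
        c (2 * k + 1) * form n (co u) (shift (2 * k - 1) (co v)) =
          c (2 * k + 1) * form n (co v) (shift (2 * k - 1) (co u)) := by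
      intro k hk
      rw [Finset.mem_Icc] at hk
      have h3 : (-1 : ℝ) ^ (2 * k - 1) = -1 := Odd.neg_one_pow ⟨k - 1, by omega⟩
      rw [form_comm n (co v), form_shift, h3]
      ring
    rw [hD, hD, Finset.sum_congr rfl hs, ← form_diag,
      form_comm n (fun m : ℕ => ((m - 2 : ℝ) * a + d) * co u m)]
    ring
  · rw [if_neg m2, if_neg m2, if_neg m2]
    by_cases m3 : 3 ≤ m
    · rw [if_pos m3, if_pos m3, co_lie _ _ m h1 h2, if_neg m2, if_pos m3,
        co_derMap _ _ _ _ _ (m - 1) (by omega) (by omega), if_neg (by omega), if_neg (by omega),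
        co_derMap _ _ _ _ _ (m - 1) (by omega) (by omega), if_neg (by omega), if_neg (by omega)]
      have hc : ∀ k ∈ Finset.Icc 2 (n - 1), c (2 * k + 1) * shift (2 * k - 1) (co ⁅u, v⁆) m =
          co u 1 * (c (2 * k + 1) * shift (2 * k - 1) (co v) (m - 1))
            - co v 1 * (c (2 * k + 1) * shift (2 * k - 1) (co u) (m - 1)) := by
        intro k hk
        rw [Finset.mem_Icc] at hk
        unfold shift
        by_cases h : 2 * k - 1 + 2 ≤ m
        · rw [if_pos h, co_lie _ _ _ (by omega) (by omega), if_neg (by omega)]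
          by_cases h' : 2 * k - 1 + 2 ≤ m - 1
          · rw [if_pos h', if_pos h', if_pos (by omega)]
            have : m - (2 * k - 1) - 1 = m - 1 - (2 * k - 1) := by omega
            rw [this]; ring
          · rw [if_neg h', if_neg h', if_neg (by omega)]; ring
        · rw [if_neg h, if_neg (by omega), if_neg (by omega)]; ring
      rw [Finset.sum_congr rfl hc, Finset.sum_sub_distrib, ← Finset.mul_sum, ← Finset.mul_sum,
        Nat.cast_sub (by omega : 1 ≤ m)]
      push_cast
      ring
    · rw [if_neg m3, if_neg m3, co_lie _ _ m h1 h2, if_neg m2, if_neg m3]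
      rw [Finset.sum_eq_zero]
      · ring
      · intro k hk
        rw [Finset.mem_Icc] at hk
        unfold shift
        rw [if_neg (by omega)]; ring

/-- `derMap` as a derivation of the Lie algebra `Q₂ₙ`. -/
def der (n : ℕ) (a d e : ℝ) (c : ℕ → ℝ) : LieDerivation ℝ (Q n) (Q n) where
  toLinearMap := derMap n a d e c
  leibniz' := derMap_lie n a d e c

/-- The semidirect sum of `Q₂ₙ` and a one-dimensional Lie algebra `ℝ Y` acting by `[Y, X] = D X`;
its elements `X + s Y` are written as `⟨X, s⟩`. -/
@[ext] structure Ext {n : ℕ} (D : LieDerivation ℝ (Q n) (Q n)) where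
  /-- The component in `Q₂ₙ`. -/
  fst : Q n
  /-- The coefficient of `Y`. -/
  snd : ℝ

section Extension

variable {n : ℕ} (D : LieDerivation ℝ (Q n) (Q n))

/-- As a vector space, `Ext D` is the product `Q₂ₙ × ℝ`. -/
def Ext.equivProd : Ext D ≃ Q n × ℝ where
  toFun v := (v.fst, v.snd)
  invFun p := ⟨p.1, p.2⟩
  left_inv _ := rfl
  right_inv _ := rfl

instance : AddCommGroup (Ext D) := (Ext.equivProd D).addCommGroup
instance : Module ℝ (Ext D) := (Ext.equivProd D).module ℝ

/-- `[X + s Y, X' + t Y] = [X, X'] + s D X' - t D X`. -/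
instance : Bracket (Ext D) (Ext D) where
  bracket v w := ⟨⁅v.fst, w.fst⁆ + v.snd • D w.fst - w.snd • D v.fst, 0⟩

variable {D}

lemma Ext.fst_lie (v w : Ext D) : (⁅v, w⁆ : Ext D).fst = ⁅v.fst, w.fst⁆ + v.snd • D w.fst - w.snd • D v.fst := rfl
lemma Ext.snd_lie (v w : Ext D) : (⁅v, w⁆ : Ext D).snd = 0 := rfl
lemma Ext.fst_add (v w : Ext D) : (v + w).fst = v.fst + w.fst := rfl
lemma Ext.snd_add (v w : Ext D) : (v + w).snd = v.snd + w.snd := rfl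
lemma Ext.fst_smul (t : ℝ) (v : Ext D) : (t • v).fst = t • v.fst := rfl
lemma Ext.snd_smul (t : ℝ) (v : Ext D) : (t • v).snd = t * v.snd := rfl
lemma Ext.fst_zero : (0 : Ext D).fst = 0 := rfl
lemma Ext.snd_zero : (0 : Ext D).snd = 0 := rfl

variable (D)

instance : LieRing (Ext D) where
  add_lie x y z := Ext.ext (by
    simp only [Ext.fst_lie, Ext.fst_add, Ext.snd_add, add_lie, map_add]; module)
    (by simp only [Ext.snd_lie, Ext.snd_add, add_zero])
  lie_add x y z := Ext.ext (by
    simp only [Ext.fst_lie, Ext.fst_add, Ext.snd_add, lie_add, map_add]; module)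
    (by simp only [Ext.snd_lie, Ext.snd_add, add_zero])
  lie_self x := Ext.ext (by
    simp only [Ext.fst_lie, Ext.fst_zero, lie_self]; module)
    (by simp only [Ext.snd_lie, Ext.snd_zero])
  leibniz_lie x y z := Ext.ext (by
    simp only [Ext.fst_lie, Ext.fst_add, Ext.snd_lie, map_add, map_sub, map_smul,
      LieDerivation.apply_lie_eq_sub, lie_add, lie_sub, add_lie, sub_lie, lie_smul, smul_lie]
    rw [leibniz_lie x.fst y.fst z.fst, ← lie_skew z.fst (D x.fst), ← lie_skew z.fst (D y.fst)]
    module)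
    (by simp only [Ext.snd_lie, Ext.snd_add, add_zero])

instance : LieAlgebra ℝ (Ext D) where
  lie_smul t x y := Ext.ext (by
    simp only [Ext.fst_lie, Ext.fst_smul, Ext.snd_smul, lie_smul, map_smul]; module)
    (by simp only [Ext.snd_lie, Ext.snd_smul, mul_zero])

/-- The basis `X₁, …, X₂ₙ, Y` of `Ext D`: `Xₖ` has index `Sum.inl k` and `Y` has index
`Sum.inr ()`. -/
def basisXY : Module.Basis (Idx n ⊕ Unit) ℝ (Ext D) :=
  Module.Basis.ofEquivFun
    { toFun := fun v => Sum.elim (fun k => co v.fst k) (fun _ => v.snd)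
      invFun := fun f => ⟨ofCo fun k => if h : k ∈ Finset.Icc 1 (2 * n) then f (Sum.inl ⟨k, h⟩)
        else 0, f (Sum.inr ())⟩
      map_add' := fun v w => by
        funext i
        rcases i with k | _
        · exact co_add v.fst w.fst k
        · rfl
      map_smul' := fun t v => by
        funext i
        rcases i with k | _
        · exact co_smul t v.fst k
        · rfl
      left_inv := fun v => Ext.ext (ext_co fun k h1 h2 => by
        have h : k ∈ Finset.Icc 1 (2 * n) := Finset.mem_Icc.2 ⟨h1, h2⟩
        rw [co_ofCo _ k h1 h2, dif_pos h]
        rfl) rfl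
      right_inv := fun f => by
        funext i
        rcases i with k | _
        · have h := Finset.mem_Icc.1 k.2
          simp only [Sum.elim_inl]
          rw [co_ofCo _ k h.1 h.2]
          exact dif_pos k.2
        · rfl }

end Extension

/-- The derivation `D` of `Q₂ₙ` for which `Ext D` is the solvable algebra `𝔯_{2n+1}(λ)`: `[Y, X₁] = X₁`, `[Y, Xₖ] = (k-2+λ) Xₖ` for `2 ≤ k ≤ 2n-1`,
`[Y, X₂ₙ] = (2n-3+2λ) X₂ₙ`. -/
abbrev derLam (n : ℕ) (lam : ℝ) : LieDerivation ℝ (Q n) (Q n) := der n 1 lam 0 0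

/-- The derivation `D` of `Q₂ₙ` for which `Ext D` is the solvable algebra `𝔯_{2n+1}(2-n, ε)`: `[Y, X₁] = X₁ + ε X₂ₙ`, `[Y, Xₖ] = (k-n) Xₖ` for
`2 ≤ k ≤ 2n-1`, `[Y, X₂ₙ] = X₂ₙ`. -/
abbrev derEps (n : ℕ) (ε : ℝ) : LieDerivation ℝ (Q n) (Q n) := der n 1 (2 - n) ε 0

/-- The derivation `D` of `Q₂ₙ` for which `Ext D` is the solvable algebra `𝔯_{2n+1}(c₅, c₇, …, c_{2n-1})`: `[Y, X₁] = 0`, `[Y, X₂ₙ] = 2 X₂ₙ` and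
`[Y, X_{2+t}] = X_{2+t} + ∑ c_{2k+1} X_{2k+1+t}` for `0 ≤ t ≤ 2n-3`, the sum being over `k ≥ 2` with
`2k+1+t ≤ 2n-1`. Only the values of `c` at `5, 7, …, 2n-1` matter. -/
abbrev derFam (n : ℕ) (c : ℕ → ℝ) : LieDerivation ℝ (Q n) (Q n) := der n 0 1 0 c

/-! ## The invariants of `Q₂ₙ` as functions of the coordinates `(x₁, …, x₂ₙ, y)` -/

/-- The coordinate function `xₖ`, `1 ≤ k ≤ 2n` (and `0` for other `k`). -/
def coord {n : ℕ} (x : Idx n ⊕ Unit → ℝ) (k : ℕ) : ℝ :=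
  if h : k ∈ Finset.Icc 1 (2 * n) then x (Sum.inl ⟨k, h⟩) else 0

/-- `I₂ = x₁ x₂ₙ + x₃ x_{2n-1} + ∑_{k=4}^n (-1)^{k+1} xₖ x_{2n+2-k} + ((-1)ⁿ / 2) x_{n+1}²`. -/
def I₂ (n : ℕ) (x : Idx n ⊕ Unit → ℝ) : ℝ :=
  coord x 1 * coord x (2 * n) + coord x 3 * coord x (2 * n - 1)
    + ∑ k ∈ Finset.Icc 4 n, (-1) ^ (k + 1) * coord x k * coord x (2 * n + 2 - k)
    + (-1) ^ n / 2 * coord x (n + 1) ^ 2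

end SolvableQ

end

namespace SolvableQ

/-! ### Coadjoint stabilizers bound the number of independent invariants. -/

section Criterion

variable {ι L : Type*} [Fintype ι] [DecidableEq ι] [LieRing L] [LieAlgebra ℝ L]

/-! The coadjoint vectors `x([u, ·])` span the tangent space of the orbit through `x`. An invariant
is stationary along them, so its differential, read as an element of the Lie algebra, lies in the
stabilizer of `x`. Where the stabilizer has dimension at most one, two invariants have dependent
differentials (`card_le_one_of_isRegularAt`). Hence it suffices to find, inside every open set, an
open set of such points carrying one invariant without critical points; this is `HasLocalInvariant`,
which is preserved by isomorphisms.

Structure: the nilradical has codimension one, so the algebra is determined by the derivation that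
one outer element `y` induces on `Q n`. Inner derivations are absorbed by changing `y`, and what
remains is some `der n a d e c` (`exists_derivation_eq`). If `a = d = 0` the whole extension would
be nilpotent (`isNilpotent_Ext`), contradicting maximality of the nilradical.

Invariants: `Q n` has the two invariants `z = x₂ₙ` and `I₂`. Put `ω = (2n-3)a + 2d`. Along `Y`, `z`
changes at rate `ω z` and `I₂` at rate `(ω+a) I₂ + e z²`; the parameters `c` drop out
(`pair_derMap_gradQuad`). So `I₂ f(z) + g(z)` is invariant as soon as `ω z f' + (ω+a) f = 0` and `ω
z g' + e z² f = 0`. If `ω = 0`, `z` itself is invariant; if `ω = a ≠ 0`, take `f = z⁻²` and `g =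
-(e/a) log |z|`; otherwise `f = |z|^(-α)` with `α = (ω+a)/ω`, and `g` is a multiple of `z² f`.

Regularity: for `z ≠ 0` the form on `X₂, …, X₂ₙ₋₁` is nondegenerate, so inside `Q n` the stabilizer
is spanned by `X₂ₙ` and the differential of `I₂`. Where the bracket with `Y` is nonzero on one of
the two, it excludes elements with a `Y`-component and leaves one dimension
(`isRegularAt_of_mem_regularSet`). -/

lemma coadjointOp_eq (b : Module.Basis ι ℝ L) (i : ι) (F : (ι → ℝ) → ℝ) (x : ι → ℝ) :
    coadjointOp b i F x = -fderiv ℝ F x (fun j => b.constr ℝ x ⁅b i, b j⁆) := by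
  rw [coadjointOp, ← LinearMap.sum_single_apply (φ := fun _ => ℝ)
    (fun j => b.constr ℝ x ⁅b i, b j⁆), map_sum]
  congr 1
  refine Finset.sum_congr rfl fun j _ => ?_
  have h : ∀ t : ℝ, fderiv ℝ F x (Pi.single j t) = t * fderiv ℝ F x (Pi.single j 1) := fun t => by
    rw [← smul_eq_mul, ← map_smul, ← Pi.single_smul, smul_eq_mul, mul_one]
  rw [← Finset.sum_mul, h (b.constr ℝ x _), Module.Basis.constr_apply_fintype]
  simp [Module.Basis.equivFun_apply]

lemma constr_coadjoint {ι L : Type*} [LieRing L] [LieAlgebra ℝ L] (b : Module.Basis ι ℝ L)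
    (x : ι → ℝ) (u w : L) :
    b.constr ℝ (fun j => b.constr ℝ x ⁅u, b j⁆) w = b.constr ℝ x ⁅u, w⁆ := by
  have h : b.constr ℝ (fun j => b.constr ℝ x ⁅u, b j⁆) = (b.constr ℝ x) ∘ₗ (LieAlgebra.ad ℝ L u) :=
    b.ext fun j => by rw [b.constr_basis]; rfl
  rw [h]; rfl

/-- `F` is stationary at `x` along the coadjoint orbit through `x`. -/
def IsStationaryAt (b : Module.Basis ι ℝ L) (F : (ι → ℝ) → ℝ) (x : ι → ℝ) : Prop :=
  ∀ u : L, fderiv ℝ F x (fun j => b.constr ℝ x ⁅u, b j⁆) = 0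

lemma forall_coadjointOp_eq_zero_iff (b : Module.Basis ι ℝ L) (F : (ι → ℝ) → ℝ) (x : ι → ℝ) :
    (∀ i, coadjointOp b i F x = 0) ↔ IsStationaryAt b F x := by
  simp only [coadjointOp_eq, neg_eq_zero]
  refine ⟨fun h u => ?_, fun h i => h (b i)⟩
  have hu : (fun j => b.constr ℝ x ⁅u, b j⁆) =
      ∑ i, b.repr u i • fun j => b.constr ℝ x ⁅b i, b j⁆ := by
    funext j
    conv_lhs => rw [← b.sum_repr u]
    simp only [sum_lie, smul_lie, map_sum, map_smul, Finset.sum_apply, Pi.smul_apply]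
  rw [hu, map_sum]
  exact Finset.sum_eq_zero fun i _ => by rw [map_smul, h i, smul_zero]

/-- The functional with coordinates `x` has a stabilizer of dimension at most one. -/
def IsRegularAt (b : Module.Basis ι ℝ L) (x : ι → ℝ) : Prop :=
  ∃ p : L →ₗ[ℝ] ℝ, ∀ w : L, (∀ u : L, b.constr ℝ x ⁅u, w⁆ = 0) → p w = 0 → w = 0

/-- The element of `L` which represents a linear functional on the dual of `L`. -/
noncomputable def ofBidual (b : Module.Basis ι ℝ L) : ((ι → ℝ) →L[ℝ] ℝ) →ₗ[ℝ] L where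
  toFun ℓ := ∑ j, ℓ (Pi.single j 1) • b j
  map_add' ℓ ℓ' := by simp [add_smul, Finset.sum_add_distrib]
  map_smul' t ℓ := by simp [mul_smul, Finset.smul_sum]

lemma ofBidual_injective (b : Module.Basis ι ℝ L) : Function.Injective (ofBidual b) := by
  refine (injective_iff_map_eq_zero _).2 fun ℓ h => ?_
  have h' := Fintype.linearIndependent_iff.1 b.linearIndependent _ h
  refine ContinuousLinearMap.coe_injective (LinearMap.pi_ext' fun j => ?_)
  ext
  simpa using h' j

lemma constr_lie_ofBidual (b : Module.Basis ι ℝ L) (ℓ : (ι → ℝ) →L[ℝ] ℝ) (x : ι → ℝ) (u : L) :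
    b.constr ℝ x ⁅u, ofBidual b ℓ⁆ = ℓ fun j => b.constr ℝ x ⁅u, b j⁆ := by
  rw [← LinearMap.sum_single_apply (φ := fun _ => ℝ) (fun j => b.constr ℝ x ⁅u, b j⁆), map_sum]
  simp only [ofBidual, LinearMap.coe_mk, AddHom.coe_mk, lie_sum, lie_smul, map_sum,
    map_smul]
  refine Finset.sum_congr rfl fun j _ => ?_
  rw [smul_eq_mul, mul_comm, ← smul_eq_mul, ← map_smul, ← Pi.single_smul,
    smul_eq_mul, mul_one]

/-- `ofBidual` sends the differentials injectively into the stabilizer of `x`, on which `p` is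
injective. Independent differentials therefore give independent real numbers, and there is at most
one of those. -/
lemma card_le_one_of_isRegularAt {b : Module.Basis ι ℝ L} {x : ι → ℝ} (hx : IsRegularAt b x)
    {m : ℕ} {F : Fin m → (ι → ℝ) → ℝ} (hF : ∀ a, IsStationaryAt b (F a) x)
    (hli : LinearIndependent ℝ fun a => fderiv ℝ (F a) x) : m ≤ 1 := by
  obtain ⟨p, hp⟩ := hx
  have h : LinearIndependent ℝ fun a => p (ofBidual b (fderiv ℝ (F a) x)) := by
    rw [Fintype.linearIndependent_iff] at hli ⊢
    intro g hg
    refine hli g (ofBidual_injective b ?_)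
    rw [map_zero]
    refine hp _ (fun u => ?_) ?_
    · rw [constr_lie_ofBidual, _root_.sum_apply]
      exact Finset.sum_eq_zero fun a _ => by
        rw [_root_.smul_apply, hF a u, smul_zero]
    · simpa only [map_sum, map_smul] using hg
  simpa using h.fintype_card_le_finrank

/-- An invariant without critical points. -/
def IsRegularInvariantOn (b : Module.Basis ι ℝ L) (U : Set (ι → ℝ)) (F : (ι → ℝ) → ℝ) : Prop :=
  IsInvariantOn b U F ∧ ∀ x ∈ U, fderiv ℝ F x ≠ 0

lemma isFundamentalOn_singleton {b : Module.Basis ι ℝ L} {U : Set (ι → ℝ)} {F : (ι → ℝ) → ℝ}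
    (hF : IsRegularInvariantOn b U F)
    (hreg : ∀ V : Set (ι → ℝ), IsOpen V → V.Nonempty → ∃ W ⊆ V, IsOpen W ∧ W.Nonempty ∧
      ∀ x ∈ W, IsRegularAt b x) : IsFundamentalOn b U ![F] := by
  refine ⟨fun a => ?_, fun V hV _ hne => ?_, fun V hV ho hne G hG hli => ?_⟩
  · rw [Subsingleton.elim a 0]; exact hF.1
  · obtain ⟨x, hx⟩ := hne
    refine ⟨x, hx, ?_⟩
    rw [linearIndependent_unique_iff]
    exact hF.2 x (hV hx)
  · obtain ⟨W, hWV, hWo, hWne, hW⟩ := hreg V ho hne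
    -- Independence is only known at some point of each open set, so it is tested on an open set
    -- consisting of regular points.
    obtain ⟨x, hxW, hl⟩ := hli W hWV hWo hWne
    have hx := hWV hxW
    refine absurd (card_le_one_of_isRegularAt (hW x hxW) (fun a => ?_) hl) (by omega)
    rw [← forall_coadjointOp_eq_zero_iff]
    intro i
    refine Fin.cases ?_ (fun a => ?_) a
    · exact hG.2 i x hx
    · rw [Subsingleton.elim a 0]
      exact hF.1.2 i x (hV hx)

/-- Every nonempty open set contains a nonempty open set of regular points on which there is an
invariant without critical points. -/
def HasLocalInvariant (b : Module.Basis ι ℝ L) : Prop :=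
  ∀ U : Set (ι → ℝ), IsOpen U → U.Nonempty → ∃ V ⊆ U, IsOpen V ∧ V.Nonempty ∧
    (∀ x ∈ V, IsRegularAt b x) ∧ ∃ F, IsRegularInvariantOn b V F

lemma HasLocalInvariant.hasExactlyInvariants {b : Module.Basis ι ℝ L}
    (h : HasLocalInvariant b) : HasExactlyInvariants b 1 := by
  intro U hU hne
  obtain ⟨V, hVU, hV, hVne, hreg, F, hF⟩ := h U hU hne
  have hreg' : ∀ V : Set (ι → ℝ), IsOpen V → V.Nonempty → ∃ W ⊆ V, IsOpen W ∧ W.Nonempty ∧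
      ∀ x ∈ W, IsRegularAt b x := fun V hV hVne => by
    obtain ⟨W, h1, h2, h3, h4, -⟩ := h V hV hVne
    exact ⟨W, h1, h2, h3, h4⟩
  have hfund := isFundamentalOn_singleton hF hreg'
  refine ⟨⟨V, hVU, hV, hVne, _, hfund⟩, fun p G hG => ?_⟩
  have hp : p ≤ 1 := by
    obtain ⟨x, hx, hl⟩ := hG.2.1 V hVU hV hVne
    refine card_le_one_of_isRegularAt (hreg x hx) (fun a => ?_) hl
    rw [← forall_coadjointOp_eq_zero_iff]
    exact fun i => (hG.1 a).2 i x (hVU hx)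
  rcases Nat.le_one_iff_eq_zero_or_eq_one.1 hp with rfl | rfl
  -- The empty family is not maximal: the local invariant `F` can be added to it on `V`.
  · have hcons : (Fin.cons F G : Fin (0 + 1) → (ι → ℝ) → ℝ) = ![F] := by
      funext a
      fin_cases a
      rfl
    refine absurd ?_ (hG.2.2 V hVU hV hVne F hF.1)
    rw [hcons]
    exact hfund.2.1
  · rfl

/-! ### Transport along isomorphisms and changes of basis. -/

variable {κ L' : Type*} [Fintype κ] [DecidableEq κ] [LieRing L'] [LieAlgebra ℝ L']

/-- The transpose of an isomorphism `L ≃ L'` in coordinates. -/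
noncomputable def dualCoordEquiv (b : Module.Basis ι ℝ L) (b' : Module.Basis κ ℝ L')
    (φ : L ≃ₗ[ℝ] L') : (ι → ℝ) ≃L[ℝ] (κ → ℝ) :=
  ((b.constr ℝ).trans (φ.congrLeft ℝ ℝ) |>.trans (b'.constr ℝ).symm).toContinuousLinearEquiv

lemma HasLocalInvariant.of_lieEquiv {b : Module.Basis ι ℝ L} {b' : Module.Basis κ ℝ L'}
    (φ : L ≃ₗ⁅ℝ⁆ L') (h : HasLocalInvariant b') : HasLocalInvariant b := by
  intro U hU hne
  set T := dualCoordEquiv b b' φ.toLinearEquiv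
  have hev : ∀ x u, b'.constr ℝ (T x) (φ u) = b.constr ℝ x u := fun x u => by
    have h : b'.constr ℝ (T x) = φ.toLinearEquiv.congrLeft ℝ ℝ (b.constr ℝ x) :=
      (b'.constr ℝ).apply_symm_apply _
    rw [h]
    exact congrArg (b.constr ℝ x) (φ.toLinearEquiv.symm_apply_apply u)
  obtain ⟨V, hVU, hV, ⟨y, hy⟩, hreg, F, hF, hdF⟩ := h (T.symm ⁻¹' U)
    (hU.preimage T.symm.continuous) (hne.preimage T.symm.surjective)
  refine ⟨T ⁻¹' V, fun x hx => by simpa using hVU hx, hV.preimage T.continuous,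
    ⟨T.symm y, by simpa using hy⟩, fun x hx => ?_, F ∘ T, ⟨?_, fun i x hx => ?_⟩, fun x hx h0 => ?_⟩
  · obtain ⟨p, hp⟩ := hreg (T x) hx
    refine ⟨p ∘ₗ φ.toLinearEquiv, fun w hw hpw => ?_⟩
    have := hp (φ w) (fun u => ?_) hpw
    · exact (map_eq_zero_iff φ φ.injective).1 this
    · obtain ⟨u, rfl⟩ := φ.surjective u
      exact (congrArg _ (φ.map_lie u w).symm).trans ((hev x _).trans (hw u))
  · exact hF.1.comp T.contDiff.contDiffOn fun x hx => hx
  · refine (forall_coadjointOp_eq_zero_iff b (F ∘ T) x).2 (fun u => ?_) i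
    have hs := (forall_coadjointOp_eq_zero_iff b' F (T x)).1 (fun i => hF.2 i _ hx) (φ u)
    rw [T.comp_right_fderiv]
    -- The transpose maps the coadjoint vector of `u` at `x` to that of `φ u` at `T x`, so
    -- stationarity is carried over by the chain rule.
    have hc : T (fun j => b.constr ℝ x ⁅u, b j⁆) = fun k => b'.constr ℝ (T x) ⁅φ u, b' k⁆ := by
      funext k
      have h2 := hev (fun j => b.constr ℝ x ⁅u, b j⁆) (φ.symm (b' k))
      rw [constr_coadjoint, ← hev, LieEquiv.map_lie, LieEquiv.apply_symm_apply] at h2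
      rw [← h2, Module.Basis.constr_basis]
    exact (congrArg (fderiv ℝ F (T x)) hc).trans hs
  · rw [T.comp_right_fderiv] at h0
    refine hdF (T x) hx (ContinuousLinearMap.ext fun v => ?_)
    simpa using DFunLike.congr_fun h0 (T.symm v)

end Criterion

/-! ## The quadratic invariant of `Q₂ₙ` -/

lemma neg_one_pow_of_odd_add {i j : ℕ} (h : Odd (i + j)) : (-1 : ℝ) ^ i = -(-1) ^ j := by
  rcases Nat.even_or_odd j with hj | hj
  · rw [hj.neg_one_pow, (Nat.odd_add.1 h |>.2 hj).neg_one_pow]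
  · rw [hj.neg_one_pow, neg_neg, (Nat.odd_add'.1 h |>.1 hj).neg_one_pow]

lemma neg_one_pow_of_even_add {i j : ℕ} (h : Even (i + j)) : (-1 : ℝ) ^ i = (-1) ^ j := by
  rw [neg_one_pow_of_odd_add (j := j + 1) (by rw [← add_assoc]; exact h.add_one), pow_succ]
  ring

lemma sum_Icc_reflect (N l m : ℕ) (h : l + m = N) (f : ℕ → ℝ) :
    ∑ j ∈ Finset.Icc l m, f (N - j) = ∑ j ∈ Finset.Icc l m, f j := by
  refine Finset.sum_nbij' (fun j => N - j) (fun j => N - j) ?_ ?_ ?_ ?_ fun _ _ => rfl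
  all_goals
    intro j hj
    simp only [Finset.mem_Icc] at *
    omega

/-- Terms opposite under the reflection cancel. Both the invariance of `I₂` under `Q n` and the
disappearance of the parameters `c` come from this cancellation. -/
lemma sum_Icc_eq_zero_of_reflect {N l m : ℕ} (h : l + m = N) {f : ℕ → ℝ}
    (hf : ∀ j, l ≤ j → j ≤ m → f (N - j) = -f j) : ∑ j ∈ Finset.Icc l m, f j = 0 := by
  have h1 := sum_Icc_reflect N l m h f
  rw [Finset.sum_congr rfl fun j hj => hf j (Finset.mem_Icc.1 hj).1 (Finset.mem_Icc.1 hj).2,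
    Finset.sum_neg_distrib] at h1
  linarith

lemma sum_Icc_one_two_mul {n : ℕ} (hn : 2 ≤ n) (f : ℕ → ℝ) :
    ∑ k ∈ Finset.Icc 1 (2 * n), f k =
      f 1 + ∑ k ∈ Finset.Icc 2 (2 * n - 1), f k + f (2 * n) := by
  obtain ⟨m, hm⟩ : ∃ m, 2 * n = m + 1 := ⟨2 * n - 1, by omega⟩
  rw [hm, Finset.sum_Icc_succ_top (by omega), Nat.add_sub_cancel,
    ← Finset.add_sum_Ioc_eq_sum_Icc (by omega : 1 ≤ m)]
  rfl

/-- The pairing of coordinate sequences `∑_{k=1}^{2n} fₖ xₖ`. -/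
def pair (n : ℕ) (f x : ℕ → ℝ) : ℝ := ∑ k ∈ Finset.Icc 1 (2 * n), f k * x k

/-- The quadratic form `x₁ x₂ₙ + ½ ∑_{j=3}^{2n-1} (-1)^{j+1} xⱼ x_{2n+2-j}`. -/
noncomputable def quad (n : ℕ) (x : ℕ → ℝ) : ℝ :=
  x 1 * x (2 * n) + 1 / 2 * ∑ j ∈ Finset.Icc 3 (2 * n - 1), (-1) ^ (j + 1) * (x j * x (2 * n + 2 - j))

/-- The differential of `quad` at `x`, as an element of `Q₂ₙ`. -/
def gradQuad (n : ℕ) (x : ℕ → ℝ) : Q n := ofCo fun m =>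
  if m = 1 then x (2 * n) else if m = 2 * n then x 1
    else if 3 ≤ m then (-1) ^ (m + 1) * x (2 * n + 2 - m) else 0

section gradQuad

variable {n : ℕ}

lemma co_gradQuad_one (hn : 2 ≤ n) (x : ℕ → ℝ) : co (gradQuad n x) 1 = x (2 * n) := by
  rw [gradQuad, co_ofCo _ _ le_rfl (by omega), if_pos rfl]

lemma co_gradQuad_two_mul (hn : 2 ≤ n) (x : ℕ → ℝ) : co (gradQuad n x) (2 * n) = x 1 := by
  rw [gradQuad, co_ofCo _ _ (by omega) le_rfl, if_neg (by omega), if_pos rfl]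

lemma co_gradQuad_two (hn : 2 ≤ n) (x : ℕ → ℝ) : co (gradQuad n x) 2 = 0 := by
  rw [gradQuad, co_ofCo _ _ (by omega) (by omega), if_neg (by omega), if_neg (by omega),
    if_neg (by omega)]

lemma co_gradQuad (x : ℕ → ℝ) {m : ℕ} (h3 : 3 ≤ m) (hm : m ≤ 2 * n - 1) :
    co (gradQuad n x) m = (-1) ^ (m + 1) * x (2 * n + 2 - m) := by
  rw [gradQuad, co_ofCo _ _ (by omega) (by omega), if_neg (by omega), if_neg (by omega),
    if_pos h3]

lemma pair_lie (hn : 2 ≤ n) (x : ℕ → ℝ) (u v : Q n) : pair n (co ⁅u, v⁆) x =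
    ∑ j ∈ Finset.Icc 2 (2 * n - 2), (co u 1 * co v j - co u j * co v 1) * x (j + 1)
      + form n (co u) (co v) * x (2 * n) := by
  rw [pair, sum_Icc_one_two_mul hn, co_lie_one _ _ (by omega), co_lie _ _ (2 * n) (by omega) le_rfl,
    if_pos rfl, ← Finset.add_sum_Ioc_eq_sum_Icc (by omega : 2 ≤ 2 * n - 1),
    co_lie _ _ 2 (by omega) (by omega), if_neg (by omega), if_neg (by omega)]
  have h : ∑ k ∈ Finset.Ioc 2 (2 * n - 1), co ⁅u, v⁆ k * x k =
      ∑ j ∈ Finset.Icc 2 (2 * n - 2), (co u 1 * co v j - co u j * co v 1) * x (j + 1) := by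
    refine Finset.sum_nbij' (fun k => k - 1) (fun k => k + 1) ?_ ?_ ?_ ?_ fun k hk => ?_
    · intro k hk; rw [Finset.mem_Ioc] at hk; rw [Finset.mem_Icc]; omega
    · intro k hk; rw [Finset.mem_Icc] at hk; rw [Finset.mem_Ioc]; omega
    · intro k hk; rw [Finset.mem_Ioc] at hk; omega
    · intro k hk; rw [Finset.mem_Icc] at hk; omega
    · rw [Finset.mem_Ioc] at hk
      rw [co_lie _ _ k (by omega) (by omega), if_neg (by omega), if_pos (by omega),
        Nat.sub_add_cancel (by omega)]
  rw [h]
  ring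

lemma form_gradQuad (hn : 2 ≤ n) (x : ℕ → ℝ) (u : ℕ → ℝ) : form n u (co (gradQuad n x)) =
    ∑ j ∈ Finset.Icc 2 (2 * n - 2), u j * x (j + 1) := by
  obtain ⟨m, hm⟩ : ∃ m, 2 * n - 1 = m + 1 := ⟨2 * n - 2, by omega⟩
  rw [form, hm, Finset.sum_Icc_succ_top (by omega), show 2 * n + 1 - (m + 1) = 2 by omega,
    co_gradQuad_two hn, mul_zero, add_zero, show 2 * n - 2 = m by omega]
  refine Finset.sum_congr rfl fun j hj => ?_
  rw [Finset.mem_Icc] at hj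
  rw [co_gradQuad _ (by omega) (by omega), show 2 * n + 2 - (2 * n + 1 - j) = j + 1 by omega,
    neg_one_pow_of_even_add (i := 2 * n + 1 - j + 1) (j := j) ⟨n + 1, by omega⟩]
  have h : (-1 : ℝ) ^ j * (-1) ^ j = 1 := by rw [← mul_pow]; norm_num
  linear_combination u j * x (j + 1) * h

/-- This is the invariance of `quad` under `Q n`. The `X₂ₙ`-component of the bracket cancels the
terms containing `x₂ₙ` from the first coordinate of `gradQuad`; the rest is odd under `j ↦ 2n+1-j`.
-/
lemma pair_lie_gradQuad (hn : 2 ≤ n) (x : ℕ → ℝ) (u : Q n) : pair n (co ⁅u, gradQuad n x⁆) x = 0 := by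
  have h : ∑ j ∈ Finset.Icc 2 (2 * n - 2), co (gradQuad n x) j * x (j + 1) = 0 := by
    rw [← Finset.add_sum_Ioc_eq_sum_Icc (by omega : 2 ≤ 2 * n - 2), co_gradQuad_two hn, zero_mul,
      zero_add]
    refine sum_Icc_eq_zero_of_reflect (N := 2 * n + 1) (l := 3) (by omega) fun j h1 h2 => ?_
    rw [co_gradQuad _ (by omega) (by omega), co_gradQuad _ (by omega) (by omega),
      neg_one_pow_of_odd_add (i := 2 * n + 1 - j + 1) (j := j + 1) ⟨n + 1, by omega⟩,
      show 2 * n + 2 - (2 * n + 1 - j) = j + 1 by omega,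
      show 2 * n + 1 - j + 1 = 2 * n + 2 - j by omega]
    ring
  rw [pair_lie hn, form_gradQuad hn, co_gradQuad_one hn, Finset.sum_mul, ← Finset.sum_add_distrib,
    Finset.sum_congr rfl fun j _ => (by ring :
      (co u 1 * co (gradQuad n x) j - co u j * x (2 * n)) * x (j + 1) + co u j * x (j + 1) * x (2 * n)
        = co u 1 * (co (gradQuad n x) j * x (j + 1))), ← Finset.mul_sum, h, mul_zero]

/-- This is the rate of change of `quad` along `Y`. Each monomial of `quad` pairs basis vectors
whose weights add up to `(2n-2)a + 2d`, which gives the first term; the shifts have odd length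
`2k-1` and contribute nothing; `e` enters only through `X₁ ↦ e X₂ₙ`. -/
lemma pair_derMap_gradQuad (hn : 2 ≤ n) (x : ℕ → ℝ) (a d e : ℝ) (c : ℕ → ℝ) :
    pair n (co (derMap n a d e c (gradQuad n x))) x =
      ((2 * n - 2) * a + 2 * d) * quad n x + e * x (2 * n) ^ 2 := by
  have hdiag : ∑ m ∈ Finset.Icc 2 (2 * n - 1), ((m - 2 : ℝ) * a + d) * co (gradQuad n x) m * x m =
      ((2 * n - 2) * a + 2 * d) * (1 / 2 *
        ∑ j ∈ Finset.Icc 3 (2 * n - 1), (-1) ^ (j + 1) * (x j * x (2 * n + 2 - j))) := by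
    rw [← Finset.add_sum_Ioc_eq_sum_Icc (by omega : 2 ≤ 2 * n - 1), co_gradQuad_two hn, mul_zero,
      zero_mul, zero_add]
    have h1 : ∑ m ∈ Finset.Icc 3 (2 * n - 1), ((m - 2 : ℝ) * a + d) * co (gradQuad n x) m * x m =
        ∑ m ∈ Finset.Icc 3 (2 * n - 1), ((m - 2 : ℝ) * a + d) *
          ((-1) ^ (m + 1) * (x m * x (2 * n + 2 - m))) :=
      Finset.sum_congr rfl fun m hm => by
        rw [Finset.mem_Icc] at hm
        rw [co_gradQuad _ hm.1 hm.2]; ring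
    have h2 := sum_Icc_reflect (2 * n + 2) 3 (2 * n - 1) (by omega)
      fun m : ℕ => ((m - 2 : ℝ) * a + d) * ((-1) ^ (m + 1) * (x m * x (2 * n + 2 - m)))
    have h3 : ∀ m ∈ Finset.Icc 3 (2 * n - 1), (((2 * n + 2 - m : ℕ) - 2 : ℝ) * a + d) *
        ((-1) ^ (2 * n + 2 - m + 1) * (x (2 * n + 2 - m) * x (2 * n + 2 - (2 * n + 2 - m)))) =
        ((2 * n - 2) * a + 2 * d) * ((-1) ^ (m + 1) * (x m * x (2 * n + 2 - m)))
          - ((m - 2 : ℝ) * a + d) * ((-1) ^ (m + 1) * (x m * x (2 * n + 2 - m))) := fun m hm => by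
      rw [Finset.mem_Icc] at hm
      rw [neg_one_pow_of_even_add (i := 2 * n + 2 - m + 1) (j := m + 1) ⟨n + 2, by omega⟩,
        show 2 * n + 2 - (2 * n + 2 - m) = m by omega, Nat.cast_sub (by omega)]
      push_cast
      ring
    rw [Finset.sum_congr rfl h3, Finset.sum_sub_distrib, ← Finset.mul_sum] at h2
    refine h1.trans ?_
    linarith
  have hshift : ∀ k ∈ Finset.Icc 2 (n - 1),
      ∑ m ∈ Finset.Icc 2 (2 * n - 1), shift (2 * k - 1) (co (gradQuad n x)) m * x m = 0 := by
    intro k hk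
    rw [Finset.mem_Icc] at hk
    -- The lower bound can be raised to `2k+2` because `gradQuad` has no `X₂`-component; the
    -- interval is then symmetric under `j ↦ 2n+2k+1-j`.
    have hsub : Finset.Icc (2 * k + 2) (2 * n - 1) ⊆ Finset.Icc 2 (2 * n - 1) :=
      Finset.Icc_subset_Icc_left (by omega)
    rw [← Finset.sum_subset hsub]
    · refine sum_Icc_eq_zero_of_reflect (N := 2 * n + 2 * k + 1) (by omega) fun j h1 h2 => ?_
      unfold shift
      rw [if_pos (by omega), if_pos (by omega), co_gradQuad _ (by omega) (by omega),
        co_gradQuad _ (by omega) (by omega),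
        neg_one_pow_of_odd_add (i := 2 * n + 2 * k + 1 - j - (2 * k - 1) + 1)
          (j := j - (2 * k - 1) + 1) ⟨n + 2 - k, by omega⟩,
        show 2 * n + 2 - (2 * n + 2 * k + 1 - j - (2 * k - 1)) = j by omega,
        show 2 * n + 2 - (j - (2 * k - 1)) = 2 * n + 2 * k + 1 - j by omega]
      ring
    · intro m hm hm'
      rw [Finset.mem_Icc] at hm hm'
      unfold shift
      split_ifs with h
      · rw [show m - (2 * k - 1) = 2 by omega, co_gradQuad_two hn, zero_mul]
      · rw [zero_mul]
  rw [pair, sum_Icc_one_two_mul hn, co_derMap _ _ _ _ _ 1 le_rfl (by omega), if_pos rfl,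
    co_derMap _ _ _ _ _ (2 * n) (by omega) le_rfl, if_neg (by omega), if_pos rfl,
    co_gradQuad_one hn, co_gradQuad_two_mul hn]
  have hmid : ∑ m ∈ Finset.Icc 2 (2 * n - 1), co (derMap n a d e c (gradQuad n x)) m * x m =
      ∑ m ∈ Finset.Icc 2 (2 * n - 1), ((m - 2 : ℝ) * a + d) * co (gradQuad n x) m * x m +
      ∑ k ∈ Finset.Icc 2 (n - 1), c (2 * k + 1) *
        ∑ m ∈ Finset.Icc 2 (2 * n - 1), shift (2 * k - 1) (co (gradQuad n x)) m * x m := by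
    simp only [Finset.mul_sum]
    rw [Finset.sum_comm, ← Finset.sum_add_distrib]
    refine Finset.sum_congr rfl fun m hm => ?_
    rw [Finset.mem_Icc] at hm
    rw [co_derMap _ _ _ _ _ m (by omega) (by omega), if_neg (by omega), if_neg (by omega), add_mul,
      Finset.sum_mul]
    simp only [mul_assoc]
  have hzero : ∑ k ∈ Finset.Icc 2 (n - 1), c (2 * k + 1) *
      ∑ m ∈ Finset.Icc 2 (2 * n - 1), shift (2 * k - 1) (co (gradQuad n x)) m * x m = 0 :=
    Finset.sum_eq_zero fun k hk => by rw [hshift k hk, mul_zero]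
  rw [hmid, hdiag, hzero, quad]
  ring

end gradQuad

/-! ## Invariants and regular points of the algebras `Ext (der n a d e c)` -/

/-- The symmetric sum in `quad` counts each product with distinct indices twice and the square of
`x_{n+1}` once. The symmetric form is the one suited to reflection arguments. -/
lemma quad_coord {n : ℕ} (hn : 3 ≤ n) (x : Idx n ⊕ Unit → ℝ) : I₂ n x = quad n (coord x) := by
  rw [I₂, quad]
  set y := coord x
  have hsplit : ∑ j ∈ Finset.Icc 3 (2 * n - 1), (-1 : ℝ) ^ (j + 1) * (y j * y (2 * n + 2 - j)) =
      ∑ j ∈ Finset.Icc 3 n, (-1 : ℝ) ^ (j + 1) * (y j * y (2 * n + 2 - j)) +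
      ((-1) ^ n * y (n + 1) ^ 2 +
      ∑ j ∈ Finset.Icc (n + 2) (2 * n - 1), (-1 : ℝ) ^ (j + 1) * (y j * y (2 * n + 2 - j))) := by
    have h1 : ∀ f : ℕ → ℝ, ∑ j ∈ Finset.Icc 3 (2 * n - 1), f j = ∑ j ∈ Finset.Icc 3 n, f j +
        (f (n + 1) + ∑ j ∈ Finset.Icc (n + 2) (2 * n - 1), f j) := fun f => by
      have h2 : Finset.Icc 3 (2 * n - 1) =
          Finset.Icc 3 n ∪ ({n + 1} ∪ Finset.Icc (n + 2) (2 * n - 1)) := by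
        ext j; simp only [Finset.mem_union, Finset.mem_singleton, Finset.mem_Icc]; omega
      rw [h2, Finset.sum_union, Finset.sum_union, Finset.sum_singleton]
      · rw [Finset.disjoint_singleton_left, Finset.mem_Icc]; omega
      · rw [Finset.disjoint_left]; intro j
        simp only [Finset.mem_union, Finset.mem_singleton, Finset.mem_Icc]; omega
    rw [h1, neg_one_pow_of_even_add (i := n + 1 + 1) (j := n) ⟨n + 1, by omega⟩,
      show 2 * n + 2 - (n + 1) = n + 1 by omega, sq]
  have hrefl : ∑ j ∈ Finset.Icc (n + 2) (2 * n - 1), (-1 : ℝ) ^ (j + 1) *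
      (y j * y (2 * n + 2 - j)) =
      ∑ j ∈ Finset.Icc 3 n, (-1 : ℝ) ^ (j + 1) * (y j * y (2 * n + 2 - j)) := by
    refine Finset.sum_nbij' (fun j => 2 * n + 2 - j) (fun j => 2 * n + 2 - j) ?_ ?_ ?_ ?_ ?_
    · intro j hj; rw [Finset.mem_Icc] at *; omega
    · intro j hj; rw [Finset.mem_Icc] at *; omega
    · intro j hj; rw [Finset.mem_Icc] at *; omega
    · intro j hj; rw [Finset.mem_Icc] at *; omega
    · intro j hj
      rw [Finset.mem_Icc] at hj
      rw [neg_one_pow_of_even_add (i := 2 * n + 2 - j + 1) (j := j + 1) ⟨n + 2, by omega⟩,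
        show 2 * n + 2 - (2 * n + 2 - j) = j by omega]
      ring
  have hfirst : ∑ j ∈ Finset.Icc 3 n, (-1 : ℝ) ^ (j + 1) * (y j * y (2 * n + 2 - j)) =
      y 3 * y (2 * n - 1) + ∑ k ∈ Finset.Icc 4 n, (-1) ^ (k + 1) * y k * y (2 * n + 2 - k) := by
    rw [← Finset.add_sum_Ioc_eq_sum_Icc hn, show 2 * n + 2 - 3 = 2 * n - 1 by omega]
    simp only [mul_assoc]
    norm_num
    rfl
  rw [hsplit, hrefl, hfirst]
  ring

/-- `coord` as a continuous linear functional. -/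
def coordL (n k : ℕ) : (Idx n ⊕ Unit → ℝ) →L[ℝ] ℝ :=
  if h : k ∈ Finset.Icc 1 (2 * n) then ContinuousLinearMap.proj (Sum.inl ⟨k, h⟩) else 0

lemma coordL_apply {n : ℕ} (k : ℕ) (x : Idx n ⊕ Unit → ℝ) : coordL n k x = coord x k := by
  unfold coordL coord
  split_ifs <;> rfl

lemma contDiff_coord (n k : ℕ) : ContDiff ℝ ∞ fun x : Idx n ⊕ Unit → ℝ => coord x k :=
  funext (coordL_apply (n := n) k) ▸ (coordL n k).contDiff

lemma contDiff_I₂ (n : ℕ) : ContDiff ℝ ∞ (I₂ n) := by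
  have h := contDiff_coord n
  unfold I₂
  refine ((((h _).mul (h _)).add ((h _).mul (h _))).add (ContDiff.sum fun k _ => ?_)).add
    (contDiff_const.mul ((h _).pow 2))
  exact (contDiff_const.mul (h _)).mul (h _)

lemma hasFDerivAt_coord (n k : ℕ) (x : Idx n ⊕ Unit → ℝ) :
    HasFDerivAt (fun x : Idx n ⊕ Unit → ℝ => coord x k) (coordL n k) x :=
  (funext (coordL_apply (n := n) k) : ⇑(coordL n k) = _) ▸ (coordL n k).hasFDerivAt

lemma constr_basisXY {n : ℕ} (D : LieDerivation ℝ (Q n) (Q n)) (x : Idx n ⊕ Unit → ℝ)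
    (u : Ext D) : (basisXY D).constr ℝ x u =
      pair n (co u.fst) (coord x) + u.snd * x (Sum.inr ()) := by
  rw [Module.Basis.constr_apply_fintype, Fintype.sum_sum_type]
  have h : (basisXY D).equivFun u = Sum.elim (fun k : Idx n => co u.fst k) (fun _ => u.snd) := by
    rw [basisXY, Module.Basis.equivFun_ofEquivFun]; rfl
  simp only [h, Sum.elim_inl, Sum.elim_inr, smul_eq_mul, Finset.univ_unique, Finset.sum_singleton,
    pair]
  congr 1
  rw [← Finset.sum_coe_sort (Finset.Icc 1 (2 * n)) fun k => co u.fst k * coord x k]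
  refine Finset.sum_congr rfl fun k _ => ?_
  rw [coord, dif_pos k.2]

/-- The basis vector `Xₖ` of `Q₂ₙ`. -/
def X (n k : ℕ) : Q n := ofCo fun m => if m = k then 1 else 0

lemma co_X {n : ℕ} (k m : ℕ) (h1 : 1 ≤ m) (h2 : m ≤ 2 * n) :
    co (X n k) m = if m = k then 1 else 0 := co_ofCo _ m h1 h2

lemma pair_X {n : ℕ} {k : ℕ} (h1 : 1 ≤ k) (h2 : k ≤ 2 * n) (x : ℕ → ℝ) :
    pair n (co (X n k)) x = x k := by
  rw [pair, Finset.sum_eq_single_of_mem k (Finset.mem_Icc.2 ⟨h1, h2⟩)]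
  · rw [co_X _ _ h1 h2, if_pos rfl, one_mul]
  · intro m hm hmk
    rw [Finset.mem_Icc] at hm
    rw [co_X _ _ hm.1 hm.2, if_neg hmk, zero_mul]

lemma lie_X_two_mul {n : ℕ} (hn : 2 ≤ n) (u : Q n) : ⁅u, X n (2 * n)⁆ = 0 := by
  have h : ∀ m, 1 ≤ m → m ≤ 2 * n - 1 → co (X n (2 * n)) m = 0 := fun m h1 h2 => by
    rw [co_X _ _ h1 (by omega), if_neg (by omega)]
  refine ext_co fun m h1 h2 => ?_
  rw [co_lie _ _ m h1 h2, co_zero, h 1 le_rfl (by omega)]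
  split_ifs
  · refine Finset.sum_eq_zero fun j hj => ?_
    rw [Finset.mem_Icc] at hj
    rw [h _ (by omega) (by omega), mul_zero]
  · rw [h _ (by omega) (by omega)]; ring
  · rfl

lemma derMap_X_two_mul {n : ℕ} (hn : 2 ≤ n) (a d e : ℝ) (c : ℕ → ℝ) :
    derMap n a d e c (X n (2 * n)) = ((2 * n - 3 : ℝ) * a + 2 * d) • X n (2 * n) := by
  refine ext_co fun m h1 h2 => ?_
  have h : ∀ m, 1 ≤ m → m ≤ 2 * n - 1 → co (X n (2 * n)) m = 0 := fun m h1 h2 => by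
    rw [co_X _ _ h1 (by omega), if_neg (by omega)]
  rw [co_derMap _ _ _ _ _ m h1 h2, co_smul, h 1 le_rfl (by omega)]
  split_ifs with hm hm'
  · rw [hm, h 1 le_rfl (by omega)]; ring
  · rw [hm']; ring
  · rw [h m h1 (by omega), Finset.sum_eq_zero]
    · ring
    · intro k hk
      rw [Finset.mem_Icc] at hk
      unfold shift
      split_ifs
      · rw [h _ (by omega) (by omega), mul_zero]
      · rw [mul_zero]

lemma pair_add (n : ℕ) (u v : Q n) (x : ℕ → ℝ) :
    pair n (co (u + v)) x = pair n (co u) x + pair n (co v) x := by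
  unfold pair
  rw [← Finset.sum_add_distrib]
  exact Finset.sum_congr rfl fun k _ => by rw [co_add, add_mul]

lemma pair_smul (n : ℕ) (t : ℝ) (u : Q n) (x : ℕ → ℝ) :
    pair n (co (t • u)) x = t * pair n (co u) x := by
  unfold pair
  rw [Finset.mul_sum]
  exact Finset.sum_congr rfl fun k _ => by rw [co_smul, mul_assoc]

lemma pair_zero (n : ℕ) (x : ℕ → ℝ) : pair n (co (0 : Q n)) x = 0 := by
  simpa using pair_smul n 0 0 x

lemma hasFDerivAt_I₂ {n : ℕ} (hn : 3 ≤ n) (x : Idx n ⊕ Unit → ℝ) :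
    ∃ A : (Idx n ⊕ Unit → ℝ) →L[ℝ] ℝ, HasFDerivAt (I₂ n) A x ∧
      ∀ v, A v = pair n (co (gradQuad n (coord x))) (coord v) := by
  have h := fun k => hasFDerivAt_coord n k x
  have hq : I₂ n = fun x => quad n (coord x) := funext (quad_coord hn)
  rw [hq]
  unfold quad
  refine ⟨_, ((h _).mul (h _)).add ((HasFDerivAt.fun_sum fun j _ =>
    ((h j).mul (h (2 * n + 2 - j))).const_mul _).const_mul _), fun v => ?_⟩
  simp only [_root_.add_apply, _root_.smul_apply, _root_.sum_apply, coordL_apply, smul_eq_mul]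
  -- The two halves of the product rule agree after `j ↦ 2n+2-j`; the resulting 2 cancels the factor
  -- `1/2` in `quad`.
  have hs : ∑ j ∈ Finset.Icc 3 (2 * n - 1), (-1 : ℝ) ^ (j + 1) *
      (coord x j * coord v (2 * n + 2 - j) + coord x (2 * n + 2 - j) * coord v j) =
      2 * ∑ j ∈ Finset.Icc 3 (2 * n - 1), co (gradQuad n (coord x)) j * coord v j := by
    simp only [mul_add, Finset.sum_add_distrib]
    have h2 : ∑ j ∈ Finset.Icc 3 (2 * n - 1), (-1 : ℝ) ^ (j + 1) *
        (coord x (2 * n + 2 - j) * coord v j) =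
        ∑ j ∈ Finset.Icc 3 (2 * n - 1), co (gradQuad n (coord x)) j * coord v j :=
      Finset.sum_congr rfl fun j hj => by
        rw [Finset.mem_Icc] at hj
        rw [co_gradQuad _ hj.1 hj.2, mul_assoc]
    rw [h2, two_mul (Finset.sum _ _), ← sum_Icc_reflect (2 * n + 2) 3 (2 * n - 1) (by omega)]
    congr 1
    refine Finset.sum_congr rfl fun j hj => ?_
    rw [Finset.mem_Icc] at hj
    rw [co_gradQuad _ hj.1 hj.2, show 2 * n + 2 - (2 * n + 2 - j) = j by omega,
      neg_one_pow_of_even_add (i := 2 * n + 2 - j + 1) (j := j + 1) ⟨n + 2, by omega⟩]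
    ring
  rw [hs, pair, sum_Icc_one_two_mul (by omega), co_gradQuad_one (by omega),
    co_gradQuad_two_mul (by omega), ← Finset.add_sum_Ioc_eq_sum_Icc (by omega : 2 ≤ 2 * n - 1),
    co_gradQuad_two (by omega)]
  have : Finset.Ioc 2 (2 * n - 1) = Finset.Icc 3 (2 * n - 1) := rfl
  rw [this]
  ring

/-! ### Derivatives along coadjoint orbits of the extensions. -/

section Ext

variable {n : ℕ} (a d e : ℝ) (c : ℕ → ℝ)

lemma constr_lie_mk (x : Idx n ⊕ Unit → ℝ) (u : Ext (der n a d e c)) (w : Q n) :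
    (basisXY (der n a d e c)).constr ℝ x ⁅u, (⟨w, 0⟩ : Ext (der n a d e c))⁆ =
      pair n (co ⁅u.fst, w⁆) (coord x) + u.snd * pair n (co (derMap n a d e c w)) (coord x) := by
  rw [constr_basisXY, Ext.fst_lie, Ext.snd_lie]
  simp only [zero_smul, sub_zero, zero_mul, add_zero, pair_add, pair_smul]
  rfl

lemma constr_lie_X_two_mul (hn : 2 ≤ n) (x : Idx n ⊕ Unit → ℝ) (u : Ext (der n a d e c)) :
    (basisXY (der n a d e c)).constr ℝ x ⁅u, (⟨X n (2 * n), 0⟩ : Ext (der n a d e c))⁆ =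
      u.snd * (((2 * n - 3) * a + 2 * d) * coord x (2 * n)) := by
  rw [constr_lie_mk, lie_X_two_mul hn, derMap_X_two_mul hn, pair_smul, pair_zero,
    pair_X (by omega) le_rfl, zero_add]

lemma constr_lie_gradQuad (hn : 3 ≤ n) (x : Idx n ⊕ Unit → ℝ) (u : Ext (der n a d e c)) :
    (basisXY (der n a d e c)).constr ℝ x
        ⁅u, (⟨gradQuad n (coord x), 0⟩ : Ext (der n a d e c))⁆ =
      u.snd * (((2 * n - 2) * a + 2 * d) * I₂ n x + e * coord x (2 * n) ^ 2) := by
  rw [constr_lie_mk, pair_lie_gradQuad (by omega), pair_derMap_gradQuad (by omega), zero_add,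
    quad_coord hn]

lemma pair_coord_coadjoint (x : Idx n ⊕ Unit → ℝ) (u : Ext (der n a d e c)) (w : Q n) :
    pair n (co w)
      (coord fun j => (basisXY (der n a d e c)).constr ℝ x ⁅u, basisXY (der n a d e c) j⁆) =
      (basisXY (der n a d e c)).constr ℝ x ⁅u, (⟨w, 0⟩ : Ext (der n a d e c))⁆ := by
  rw [← constr_coadjoint, constr_basisXY, zero_mul, add_zero]

variable {a d e c}

lemma hasFDerivAt_mul_add (hn : 3 ≤ n) {x : Idx n ⊕ Unit → ℝ} {f g : ℝ → ℝ} {f' g' : ℝ}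
    (hf : HasDerivAt f f' (coord x (2 * n))) (hg : HasDerivAt g g' (coord x (2 * n))) :
    ∀ v, fderiv ℝ (fun x => I₂ n x * f (coord x (2 * n)) + g (coord x (2 * n))) x v =
      f (coord x (2 * n)) * pair n (co (gradQuad n (coord x))) (coord v) +
        (I₂ n x * f' + g') * coord v (2 * n) := by
  intro v
  obtain ⟨A, hA, hAv⟩ := hasFDerivAt_I₂ hn x
  have hz := hasFDerivAt_coord n (2 * n) x
  have hJ : HasFDerivAt (fun x => I₂ n x * f (coord x (2 * n)) + g (coord x (2 * n))) _ x :=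
    (hA.mul (hf.comp_hasFDerivAt x hz)).add (hg.comp_hasFDerivAt x hz)
  rw [hJ.fderiv]
  simp only [_root_.add_apply, _root_.smul_apply, coordL_apply, smul_eq_mul, hAv, Function.comp]
  ring

/-- Along the coadjoint vector of `u`, both `x₂ₙ` and `I₂` change only through the `Y`-coefficient
of `u`. The chain rule then gives `I₂` times the left side of `h1` plus the left side of `h2`. -/
lemma isStationaryAt_mul_add (hn : 3 ≤ n) {x : Idx n ⊕ Unit → ℝ} {f g : ℝ → ℝ} {f' g' : ℝ}
    (hf : HasDerivAt f f' (coord x (2 * n))) (hg : HasDerivAt g g' (coord x (2 * n)))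
    (h1 : ((2 * n - 3) * a + 2 * d) * coord x (2 * n) * f' +
      ((2 * n - 2) * a + 2 * d) * f (coord x (2 * n)) = 0)
    (h2 : ((2 * n - 3) * a + 2 * d) * coord x (2 * n) * g' +
      e * coord x (2 * n) ^ 2 * f (coord x (2 * n)) = 0) :
    IsStationaryAt (basisXY (der n a d e c))
      (fun x => I₂ n x * f (coord x (2 * n)) + g (coord x (2 * n))) x := by
  intro u
  rw [hasFDerivAt_mul_add hn hf hg, ← pair_X (by omega : 1 ≤ 2 * n) le_rfl
    (coord fun j => (basisXY (der n a d e c)).constr ℝ x ⁅u, basisXY (der n a d e c) j⁆), pair_coord_coadjoint, pair_coord_coadjoint, constr_lie_gradQuad _ _ _ _ hn,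
    constr_lie_X_two_mul _ _ _ _ (by omega)]
  linear_combination u.snd * I₂ n x * h1 + u.snd * h2

end Ext

/-! ### Regular points, their density, and a family of invariants. -/

section Ext

variable {n : ℕ} {a d e : ℝ} {c : ℕ → ℝ}

lemma fderiv_mul_add_ne_zero (hn : 3 ≤ n) {x : Idx n ⊕ Unit → ℝ} {f g : ℝ → ℝ} {f' g' : ℝ}
    (hf : HasDerivAt f f' (coord x (2 * n))) (hg : HasDerivAt g g' (coord x (2 * n)))
    (h0 : f (coord x (2 * n)) * coord x (2 * n) ≠ 0) :
    fderiv ℝ (fun x => I₂ n x * f (coord x (2 * n)) + g (coord x (2 * n))) x ≠ 0 := by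
  intro h
  -- The variable `x₁` occurs only in the term `x₁ x₂ₙ` of `I₂`, so the partial derivative along it
  -- is `f(x₂ₙ) x₂ₙ`.
  have h1 := hasFDerivAt_mul_add hn hf hg
    (Pi.single (Sum.inl ⟨1, Finset.mem_Icc.2 ⟨le_rfl, by omega⟩⟩) 1)
  have hc : ∀ k, coord (Pi.single (Sum.inl ⟨1, Finset.mem_Icc.2 ⟨le_rfl, by omega⟩⟩) 1 :
      Idx n ⊕ Unit → ℝ) k = if k = 1 then 1 else 0 := fun k => by
    unfold coord
    split_ifs with h2 h3 h3
    · subst h3; rw [Pi.single_eq_same]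
    · exact Pi.single_eq_of_ne (by simpa using h3) _
    · rw [Finset.mem_Icc] at h2; omega
    · rfl
  rw [h, pair, Finset.sum_eq_single_of_mem 1 (Finset.mem_Icc.2 ⟨le_rfl, by omega⟩), hc, hc,
    if_pos rfl, if_neg (by omega), co_gradQuad_one (by omega)] at h1
  · rw [_root_.zero_apply] at h1
    exact h0 (by linarith)
  · intro m _ hm
    rw [hc, if_neg hm, mul_zero]

/-- If `w` has no component along `X₁` and the functional with coordinates `x` vanishes on
`[Xₖ, w]` for `2 ≤ k ≤ 2n-1`, then `w` is a multiple of `X₂ₙ`. -/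
lemma eq_smul_X_of_pair_lie_eq_zero (hn : 2 ≤ n) {x : ℕ → ℝ} (hx : x (2 * n) ≠ 0) {w : Q n}
    (hw : ∀ u : Q n, pair n (co ⁅u, w⁆) x = 0) (h1 : co w 1 = 0) :
    w = co w (2 * n) • X n (2 * n) := by
  refine ext_co fun m hm1 hm2 => ?_
  rw [co_smul, co_X _ _ hm1 hm2]
  split_ifs with hm
  · rw [hm, mul_one]
  rw [mul_zero]
  rcases eq_or_ne m 1 with rfl | hm'
  · exact h1
  have hX : ∀ j, 1 ≤ j → j ≤ 2 * n → co (X n (2 * n + 1 - m)) j =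
      if j = 2 * n + 1 - m then 1 else 0 := fun j => co_X _ j
  -- The test vector is the partner of `Xₘ` under the form; the pairing reduces to `± wₘ x₂ₙ`, since
  -- neither argument has an `X₁`-component.
  have h2 := hw (X n (2 * n + 1 - m))
  rw [pair_lie hn, hX 1 le_rfl (by omega), if_neg (by omega), h1, Finset.sum_eq_zero, form,
    Finset.sum_eq_single_of_mem (2 * n + 1 - m), hX _ (by omega) (by omega), if_pos rfl,
    show 2 * n + 1 - (2 * n + 1 - m) = m by omega] at h2
  · simpa [hx] using h2
  · rw [Finset.mem_Icc]; omega
  · intro j hj hjm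
    rw [Finset.mem_Icc] at hj
    rw [hX j (by omega) (by omega), if_neg hjm, mul_zero, zero_mul]
  · intro j _
    ring

/-- The set of points where the coordinate `x₂ₙ` and, if `x₂ₙ` is invariant, also the derivative of
`I₂` along `Y` do not vanish. -/
def regularSet (n : ℕ) (a d e : ℝ) : Set (Idx n ⊕ Unit → ℝ) :=
  {x | coord x (2 * n) ≠ 0 ∧
    ((2 * n - 3) * a + 2 * d = 0 → a * I₂ n x + e * coord x (2 * n) ^ 2 ≠ 0)}

lemma isRegularAt_of_mem_regularSet (hn : 3 ≤ n) {x : Idx n ⊕ Unit → ℝ}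
    (hx : x ∈ regularSet n a d e) : IsRegularAt (basisXY (der n a d e c)) x := by
  obtain ⟨hz, hx⟩ := hx
  have hfst : ∀ w : Ext (der n a d e c), w.snd = 0 →
      (∀ u : Ext (der n a d e c), (basisXY (der n a d e c)).constr ℝ x ⁅u, w⁆ = 0) →
      (∀ u : Q n, pair n (co ⁅u, w.fst⁆) (coord x) = 0) ∧
        pair n (co (derMap n a d e c w.fst)) (coord x) = 0 := fun w hs hw => by
    obtain ⟨w, s⟩ := w
    obtain rfl : s = 0 := hs
    refine ⟨fun u => ?_, ?_⟩
    · have := hw ⟨u, 0⟩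
      rwa [constr_lie_mk, zero_mul, add_zero] at this
    · have := hw ⟨0, 1⟩
      rwa [constr_lie_mk, one_mul, zero_lie, pair_zero, zero_add] at this
  by_cases hω : (2 * n - 3) * a + 2 * d = 0
  · have hI := hx hω
    have hω' : (2 * n - 2) * a + 2 * d = a := by linarith
    refine ⟨{ toFun := fun w => co w.fst (2 * n), map_add' := fun v w => co_add _ _ _,
              map_smul' := fun t w => co_smul _ _ _ }, fun w hw hp => ?_⟩
    -- As `X₂ₙ` has weight zero here, the `Y`-component is detected by `gradQuad`, on which `Y`
    -- pairs to the nonzero number in `hI`.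
    have hs : w.snd = 0 := by
      have h := hw ⟨gradQuad n (coord x), 0⟩
      rw [← lie_skew, map_neg, constr_lie_gradQuad _ _ _ _ hn, neg_eq_zero, hω'] at h
      exact (mul_eq_zero.1 h).resolve_right hI
    obtain ⟨hwQ, hwY⟩ := hfst w hs hw
    -- Subtracting a multiple of `gradQuad` removes the `X₁`-component without leaving the
    -- stabilizer in `Q n`, so the difference is a multiple of `X₂ₙ`. Applying the derivation then
    -- forces `w₁ = 0`.
    have hdecomp := eq_smul_X_of_pair_lie_eq_zero (by omega) hz
      (w := w.fst + (-(co w.fst 1 / coord x (2 * n))) • gradQuad n (coord x)) (fun u => by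
        rw [lie_add, lie_smul, pair_add, pair_smul, hwQ, pair_lie_gradQuad (by omega), mul_zero,
          add_zero]) (by
        rw [co_add, co_smul, co_gradQuad_one (by omega)]
        field_simp
        ring)
    have h1 : co w.fst 1 = 0 := by
      have h := congrArg (fun v => pair n (co (derMap n a d e c v)) (coord x)) hdecomp
      simp only [map_add, map_smul, pair_add, pair_smul, hwY, derMap_X_two_mul (by omega : 2 ≤ n),
        hω, pair_derMap_gradQuad (by omega : 2 ≤ n), ← quad_coord hn, hω', zero_mul, mul_zero,
        zero_add] at h
      have h2 := (mul_eq_zero.1 h).resolve_right hI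
      rw [neg_eq_zero, div_eq_zero_iff] at h2
      exact h2.resolve_right hz
    have hw0 : w.fst = 0 := by
      rw [eq_smul_X_of_pair_lie_eq_zero (by omega) hz hwQ h1]
      exact (congrArg (· • X n (2 * n)) hp).trans (zero_smul _ _)
    exact Ext.ext hw0 hs
  · refine ⟨{ toFun := fun w => co w.fst 1, map_add' := fun v w => co_add _ _ _,
              map_smul' := fun t w => co_smul _ _ _ }, fun w hw hp => ?_⟩
    have hs : w.snd = 0 := by
      have h := hw ⟨X n (2 * n), 0⟩
      rw [← lie_skew, map_neg, constr_lie_X_two_mul _ _ _ _ (by omega), neg_eq_zero] at h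
      exact (mul_eq_zero.1 h).resolve_right (mul_ne_zero hω hz)
    obtain ⟨hwQ, hwY⟩ := hfst w hs hw
    have hdecomp := eq_smul_X_of_pair_lie_eq_zero (by omega) hz hwQ hp
    rw [hdecomp, map_smul, derMap_X_two_mul (by omega), pair_smul, pair_smul,
      pair_X (by omega) le_rfl] at hwY
    have h2n := (mul_eq_zero.1 hwY).resolve_right (mul_ne_zero hω hz)
    exact Ext.ext (by rw [hdecomp, h2n, zero_smul]; rfl) hs

lemma isOpen_regularSet (n : ℕ) (a d e : ℝ) : IsOpen (regularSet n a d e) := by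
  have hz := (contDiff_coord n (2 * n)).continuous
  have hI := (contDiff_I₂ n).continuous
  refine (isOpen_ne_fun hz continuous_const).inter ?_
  by_cases hω : (2 * n - 3) * a + 2 * d = 0
  · simp only [hω, true_imp_iff]
    exact isOpen_ne_fun ((continuous_const.mul hI).add (continuous_const.mul (hz.pow 2)))
      continuous_const
  · simp only [hω, false_imp_iff]
    exact isOpen_univ

lemma exists_add_smul_mem {E : Type*} [NormedAddCommGroup E] [NormedSpace ℝ E] {U : Set E}
    (hU : IsOpen U) {x : E} (hx : x ∈ U) (v : E) (t₀ : ℝ) : ∃ t ≠ t₀, x + t • v ∈ U := by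
  have hc : Continuous fun t : ℝ => x + t • v := by fun_prop
  obtain ⟨t, ht, ht'⟩ := (dense_compl_singleton t₀).inter_open_nonempty _ (hU.preimage hc)
    ⟨0, by simpa using hx⟩
  exact ⟨t, ht', ht⟩

/-- A small move in `x₂ₙ` makes it nonzero. If `x₂ₙ` has weight zero then `a ≠ 0`, and the second
condition is affine in `x₁` with slope `a x₂ₙ ≠ 0`, so a move in `x₁` avoids its only zero. -/
lemma inter_regularSet_nonempty (hn : 3 ≤ n) (h : a ≠ 0 ∨ d ≠ 0) {U : Set (Idx n ⊕ Unit → ℝ)}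
    (hU : IsOpen U) (hne : U.Nonempty) : (U ∩ regularSet n a d e).Nonempty := by
  have hcoord : ∀ (x : Idx n ⊕ Unit → ℝ) (i : ℕ) (hi : i ∈ Finset.Icc 1 (2 * n)) (t : ℝ) (k : ℕ),
      coord (x + t • Pi.single (Sum.inl ⟨i, hi⟩) 1) k = coord x k + if k = i then t else 0 := by
    intro x i hi t k
    unfold coord
    split_ifs with h2 h3 h3
    · subst h3; simp
    · have : (Sum.inl ⟨k, h2⟩ : Idx n ⊕ Unit) ≠ Sum.inl ⟨i, hi⟩ := by simpa using h3
      rw [Pi.add_apply, Pi.smul_apply, Pi.single_eq_of_ne this, smul_zero]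
    · subst h3; exact absurd hi h2
    · simp
  obtain ⟨x₀, hx₀⟩ := hne
  obtain ⟨t, ht, hx⟩ := exists_add_smul_mem hU hx₀
    (Pi.single (Sum.inl ⟨2 * n, Finset.mem_Icc.2 ⟨by omega, le_rfl⟩⟩) 1) (-coord x₀ (2 * n))
  set x := x₀ + t • (Pi.single (Sum.inl ⟨2 * n, Finset.mem_Icc.2 ⟨by omega, le_rfl⟩⟩) 1 :
    Idx n ⊕ Unit → ℝ) with hxdef
  have hz : coord x (2 * n) ≠ 0 := by
    rw [hxdef, hcoord, if_pos rfl]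
    exact fun h => ht (by linarith)
  clear_value x
  by_cases hω : (2 * n - 3) * a + 2 * d = 0
  swap
  · exact ⟨x, hx, hz, fun h => absurd h hω⟩
  have ha : a ≠ 0 := by
    rintro rfl
    rcases h with h | h
    · exact h rfl
    · exact h (by linarith)
  obtain ⟨s, hs, hy⟩ := exists_add_smul_mem hU hx
    (Pi.single (Sum.inl ⟨1, Finset.mem_Icc.2 ⟨le_rfl, by omega⟩⟩) 1)
    (-(a * I₂ n x + e * coord x (2 * n) ^ 2) / (a * coord x (2 * n)))
  refine ⟨_, hy, ?_, fun _ => ?_⟩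
  · rwa [hcoord, if_neg (by omega), add_zero]
  · have hI : I₂ n (x + s • Pi.single (Sum.inl ⟨1, Finset.mem_Icc.2 ⟨le_rfl, by omega⟩⟩) 1) =
        I₂ n x + s * coord x (2 * n) := by
      have hk : ∀ k, k ≠ 1 → coord (x + s • Pi.single
          (Sum.inl ⟨1, Finset.mem_Icc.2 ⟨le_rfl, by omega⟩⟩) 1) k = coord x k := fun k hk => by
        rw [hcoord, if_neg hk, add_zero]
      have hsum := Finset.sum_congr (rfl : Finset.Icc 3 (2 * n - 1) = _) fun j hj =>
        have hj := Finset.mem_Icc.1 hj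
        congrArg ((-1 : ℝ) ^ (j + 1) * ·)
          (congrArg₂ (· * ·) (hk j (by omega)) (hk (2 * n + 2 - j) (by omega)))
      rw [quad_coord hn, quad_coord hn, quad, quad, hcoord x 1, if_pos rfl, hk _ (by omega), hsum]
      ring
    rw [hI, hcoord, if_neg (by omega), add_zero]
    intro h0
    refine hs ((eq_div_iff (mul_ne_zero ha hz)).2 ?_)
    linarith

lemma exists_isRegularAt (hn : 3 ≤ n) (h : a ≠ 0 ∨ d ≠ 0) (V : Set (Idx n ⊕ Unit → ℝ))
    (hV : IsOpen V) (hne : V.Nonempty) : ∃ W ⊆ V, IsOpen W ∧ W.Nonempty ∧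
      ∀ x ∈ W, IsRegularAt (basisXY (der n a d e c)) x :=
  ⟨V ∩ regularSet n a d e, Set.inter_subset_left, hV.inter (isOpen_regularSet n a d e),
    inter_regularSet_nonempty hn h hV hne, fun _ hx => isRegularAt_of_mem_regularSet hn hx.2⟩

/-- The coordinate function `x₂ₙ` is an invariant if it has weight zero. -/
lemma isInvariantOn_coord (hn : 3 ≤ n) (hω : (2 * n - 3) * a + 2 * d = 0)
    (U : Set (Idx n ⊕ Unit → ℝ)) :
    IsInvariantOn (basisXY (der n a d e c)) U fun x => coord x (2 * n) := by
  refine ⟨(contDiff_coord n _).contDiffOn, fun i x _ =>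
    (forall_coadjointOp_eq_zero_iff _ _ x).2 (fun u => ?_) i⟩
  have h := isStationaryAt_mul_add (a := a) (d := d) (e := e) (c := c) hn (x := x)
    (hasDerivAt_const _ (0 : ℝ)) (hasDerivAt_id _) (by ring) (by rw [hω]; ring) u
  simpa using h

lemma fderiv_coord_ne_zero (hn : 1 ≤ n) (x : Idx n ⊕ Unit → ℝ) :
    fderiv ℝ (fun x : Idx n ⊕ Unit → ℝ => coord x (2 * n)) x ≠ 0 := by
  rw [(hasFDerivAt_coord n (2 * n) x).fderiv]
  intro h
  have h1 := DFunLike.congr_fun h (fun _ => 1)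
  rw [coordL_apply, coord, dif_pos (Finset.mem_Icc.2 ⟨by omega, le_rfl⟩)] at h1
  exact one_ne_zero h1

/-- Invariants of the form `I₂ f(x₂ₙ) + g(x₂ₙ)`. -/
lemma isInvariantOn_mul_add (hn : 3 ≤ n) {S : Set ℝ} {f g f' g' : ℝ → ℝ}
    {U : Set (Idx n ⊕ Unit → ℝ)} (hU : ∀ x ∈ U, coord x (2 * n) ∈ S)
    (hfc : ContDiffOn ℝ ∞ f S) (hgc : ContDiffOn ℝ ∞ g S)
    (hf : ∀ z ∈ S, HasDerivAt f (f' z) z) (hg : ∀ z ∈ S, HasDerivAt g (g' z) z)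
    (h1 : ∀ z ∈ S, ((2 * n - 3) * a + 2 * d) * z * f' z + ((2 * n - 2) * a + 2 * d) * f z = 0)
    (h2 : ∀ z ∈ S, ((2 * n - 3) * a + 2 * d) * z * g' z + e * z ^ 2 * f z = 0) :
    IsInvariantOn (basisXY (der n a d e c)) U
      fun x => I₂ n x * f (coord x (2 * n)) + g (coord x (2 * n)) := by
  have hz := (contDiff_coord n (2 * n)).contDiffOn (s := U)
  refine ⟨((contDiff_I₂ n).contDiffOn.mul (hfc.comp hz hU)).add (hgc.comp hz hU), fun i x hx =>
    (forall_coadjointOp_eq_zero_iff _ _ x).2 ?_ i⟩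
  exact isStationaryAt_mul_add hn (hf _ (hU x hx)) (hg _ (hU x hx)) (h1 _ (hU x hx))
    (h2 _ (hU x hx))

end Ext

/-! ### Explicit invariants for every weight of `X₂ₙ`. -/

section Ext

variable {n : ℕ} {a d e : ℝ} {c : ℕ → ℝ}

lemma isRegularInvariantOn_mul_add (hn : 3 ≤ n) {S : Set ℝ} {f g f' g' : ℝ → ℝ}
    {U : Set (Idx n ⊕ Unit → ℝ)} (hU : ∀ x ∈ U, coord x (2 * n) ∈ S)
    (hfc : ContDiffOn ℝ ∞ f S) (hgc : ContDiffOn ℝ ∞ g S)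
    (hf : ∀ z ∈ S, HasDerivAt f (f' z) z) (hg : ∀ z ∈ S, HasDerivAt g (g' z) z)
    (h1 : ∀ z ∈ S, ((2 * n - 3) * a + 2 * d) * z * f' z + ((2 * n - 2) * a + 2 * d) * f z = 0)
    (h2 : ∀ z ∈ S, ((2 * n - 3) * a + 2 * d) * z * g' z + e * z ^ 2 * f z = 0)
    (h0 : ∀ z ∈ S, f z * z ≠ 0) :
    IsRegularInvariantOn (basisXY (der n a d e c)) U
      fun x => I₂ n x * f (coord x (2 * n)) + g (coord x (2 * n)) :=
  ⟨isInvariantOn_mul_add hn hU hfc hgc hf hg h1 h2, fun x hx =>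
    fderiv_mul_add_ne_zero hn (hf _ (hU x hx)) (hg _ (hU x hx)) (h0 _ (hU x hx))⟩

lemma isRegularInvariantOn_coord (hn : 3 ≤ n) (hω : (2 * n - 3) * a + 2 * d = 0) (U : Set (Idx n ⊕ Unit → ℝ)) :
    IsRegularInvariantOn (basisXY (der n a d e c)) U fun x => coord x (2 * n) :=
  ⟨isInvariantOn_coord hn hω U, fun x _ => fderiv_coord_ne_zero (by omega) x⟩

/-- The invariant if `Y` acts with the same weight on `X₁` and `X₂ₙ`. -/
lemma isRegularInvariantOn_log (hn : 3 ≤ n) (ha : a ≠ 0) (hω : (2 * n - 3) * a + 2 * d = a)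
    {U : Set (Idx n ⊕ Unit → ℝ)} (hU : ∀ x ∈ U, coord x (2 * n) ≠ 0) :
    IsRegularInvariantOn (basisXY (der n a d e c)) U
      fun x => I₂ n x / coord x (2 * n) ^ 2 - e / a * Real.log (coord x (2 * n)) := by
  have h := isRegularInvariantOn_mul_add (e := e) (c := c) hn (S := {0}ᶜ)
    (f := fun z => (z ^ 2)⁻¹) (f' := fun z => -(2 * z) / (z ^ 2) ^ 2)
    (g := fun z => -(e / a * Real.log z)) (g' := fun z => -(e / a * z⁻¹)) hU
    (ContDiffOn.inv (contDiff_id.pow 2).contDiffOn fun z hz => pow_ne_zero 2 hz)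
    (contDiffOn_const.mul Real.contDiffOn_log).neg
    (fun z hz => by simpa using (hasDerivAt_pow 2 z).fun_inv (pow_ne_zero 2 hz))
    (fun z hz => ((Real.hasDerivAt_log hz).const_mul _).neg)
    (fun z hz => by
      have hz : z ≠ 0 := hz
      rw [hω, show (2 * n - 2) * a + 2 * d = 2 * a by linarith]
      field_simp
      ring)
    (fun z hz => by
      have hz : z ≠ 0 := hz
      rw [hω]
      field_simp
      ring)
    (fun z hz => mul_ne_zero (inv_ne_zero (pow_ne_zero 2 hz)) hz)
  simpa only [div_eq_mul_inv, sub_eq_add_neg] using h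

/-- The invariant if `Y` acts with different weights on `X₁` and `X₂ₙ`. -/
lemma isRegularInvariantOn_exp (hn : 3 ≤ n) (hω : (2 * n - 3) * a + 2 * d ≠ 0)
    (ha : (2 * n - 3) * a + 2 * d - a ≠ 0)
    {U : Set (Idx n ⊕ Unit → ℝ)} (hU : ∀ x ∈ U, coord x (2 * n) ≠ 0) :
    IsRegularInvariantOn (basisXY (der n a d e c)) U
      fun x => I₂ n x * Real.exp (-(((2 * n - 2) * a + 2 * d) / ((2 * n - 3) * a + 2 * d)) *
          Real.log (coord x (2 * n))) +
        -(e / ((2 * n - 3) * a + 2 * d - a)) * (coord x (2 * n) ^ 2 *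
          Real.exp (-(((2 * n - 2) * a + 2 * d) / ((2 * n - 3) * a + 2 * d)) *
          Real.log (coord x (2 * n)))) := by
  have hβ : (2 * n - 2) * a + 2 * d = ((2 * n - 3) * a + 2 * d) + a := by ring
  rw [hβ]
  set wt := (2 * n - 3) * a + 2 * d with hωdef
  set α := (wt + a) / wt
  have hαω : wt * α = wt + a := mul_div_cancel₀ _ hω
  clear_value wt α
  -- Since `Real.log z` is `log |z|`, this exponential is `|z|^(-α)`, and one formula covers both
  -- signs of `x₂ₙ`.
  have hexp : ∀ z : ℝ, z ≠ 0 → HasDerivAt (fun z => Real.exp (-α * Real.log z))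
      (Real.exp (-α * Real.log z) * (-α * z⁻¹)) z := fun z hz =>
    ((Real.hasDerivAt_log hz).const_mul _).exp
  have hcd : ContDiffOn ℝ ∞ (fun z => Real.exp (-α * Real.log z)) {0}ᶜ :=
    (contDiffOn_const.mul Real.contDiffOn_log).exp
  -- With `g = κ z² f`, the second equation reads `wt (2 - α) κ + e = 0`, and `wt (2 - α) = wt - a`
  -- gives the constant.
  refine isRegularInvariantOn_mul_add hn (S := {0}ᶜ) (f := fun z => Real.exp (-α * Real.log z))
    (g := fun z => -(e / (wt - a)) * (z ^ 2 * Real.exp (-α * Real.log z))) hU hcd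
    (contDiffOn_const.mul ((contDiff_id.pow 2).contDiffOn.mul hcd)) hexp
    (fun z hz => ((hasDerivAt_pow 2 z).mul (hexp z hz)).const_mul _) (fun z hz => ?_)
    (fun z hz => ?_) fun z hz => mul_ne_zero (Real.exp_pos _).ne' hz
  · have hz : z ≠ 0 := hz
    rw [hβ, ← hωdef]
    field_simp
    linear_combination -Real.exp (-(α * Real.log z)) * hαω
  · have hz : z ≠ 0 := hz
    rw [← hωdef]
    field_simp
    simp only [Nat.cast_ofNat, Nat.add_one_sub_one, pow_one]
    linear_combination e * z ^ 2 * Real.exp (-(α * Real.log z)) * hαω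

lemma hasLocalInvariant_der (hn : 3 ≤ n) (h : a ≠ 0 ∨ d ≠ 0) :
    HasLocalInvariant (basisXY (der n a d e c)) := by
  intro U hU hne
  refine ⟨U ∩ regularSet n a d e, Set.inter_subset_left, hU.inter (isOpen_regularSet n a d e),
    inter_regularSet_nonempty hn h hU hne, fun _ hx => isRegularAt_of_mem_regularSet hn hx.2, ?_⟩
  by_cases hω : (2 * n - 3) * a + 2 * d = 0
  · exact ⟨_, isRegularInvariantOn_coord hn hω _⟩
  by_cases ha : (2 * n - 3) * a + 2 * d = a
  · exact ⟨_, isRegularInvariantOn_log hn (ha ▸ hω) ha fun x hx => hx.2.1⟩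
  · exact ⟨_, isRegularInvariantOn_exp hn hω (sub_ne_zero.2 ha) fun x hx => hx.2.1⟩

lemma IsRegularInvariantOn.isFundamentalOn_der (hn : 3 ≤ n) (h : a ≠ 0 ∨ d ≠ 0)
    {U : Set (Idx n ⊕ Unit → ℝ)} {F : (Idx n ⊕ Unit → ℝ) → ℝ}
    (hF : IsRegularInvariantOn (basisXY (der n a d e c)) U F) :
    IsFundamentalOn (basisXY (der n a d e c)) U ![F] :=
  isFundamentalOn_singleton hF (exists_isRegularAt hn h)

end Ext

/-! ### Fundamental invariants of the listed algebras. -/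

lemma isFundamentalOn_derLam {n : ℕ} (hn : 3 ≤ n) {lam : ℝ} (h : 2 * n - 3 + 2 * lam ≠ 0) :
    IsFundamentalOn (basisXY (derLam n lam)) {x | 0 < coord x (2 * n)}
      ![fun x => I₂ n x *
        coord x (2 * n) ^ (-((2 * n - 2 + 2 * lam) / (2 * n - 3 + 2 * lam)))] := by
  refine IsRegularInvariantOn.isFundamentalOn_der hn (Or.inl one_ne_zero) ?_
  set α := (2 * n - 2 + 2 * lam) / (2 * n - 3 + 2 * lam)
  have hα' : (2 * n - 3 + 2 * lam) * α = 2 * n - 2 + 2 * lam := mul_div_cancel₀ _ h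
  have key := isRegularInvariantOn_mul_add (a := 1) (d := lam) (e := 0) (c := 0) hn
    (S := Set.Ioi 0) (f := fun z => z ^ (-α)) (f' := fun z => -α * z ^ (-α - 1))
    (g := fun _ => 0) (g' := fun _ => 0) (U := {x | 0 < coord x (2 * n)}) (fun x hx => hx)
    (fun z hz => (Real.contDiffAt_rpow_const_of_ne (ne_of_gt hz)).contDiffWithinAt)
    contDiffOn_const (fun z hz => Real.hasDerivAt_rpow_const (Or.inl (ne_of_gt hz)))
    (fun z _ => hasDerivAt_const z 0) (fun z hz => ?_) (fun z _ => by ring)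
    (fun z hz => mul_ne_zero (Real.rpow_pos_of_pos hz _).ne' (ne_of_gt hz))
  · simpa only [add_zero] using key
  · have hz : 0 < z := hz
    have : z * z ^ (-α - 1) = z ^ (-α) := by
      rw [Real.rpow_sub_one hz.ne']; field_simp
    linear_combination (-α * (2 * n - 3 + 2 * lam)) * this - z ^ (-α) * hα'

/-- With `a = 1` and `d = 2 - n`, `X₁` and `X₂ₙ` both have weight 1. In this resonant case `ε`
produces a logarithm. -/
lemma isFundamentalOn_derEps {n : ℕ} (hn : 3 ≤ n) (ε : ℝ) :
    IsFundamentalOn (basisXY (derEps n ε)) {x | 0 < coord x (2 * n)}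
      ![fun x => I₂ n x / coord x (2 * n) ^ 2 - ε * Real.log (coord x (2 * n))] := by
  refine IsRegularInvariantOn.isFundamentalOn_der hn (Or.inl one_ne_zero) ?_
  have key := isRegularInvariantOn_log (a := 1) (d := 2 - n) (e := ε) (c := 0) hn one_ne_zero
    (by ring) (U := {x | 0 < coord x (2 * n)}) fun x hx => ne_of_gt hx
  simpa only [div_one] using key

/-- With `a = 0` and `d = 1`, `I₂` and `x₂ₙ` both have weight 2, so their quotient is invariant. -/
lemma isFundamentalOn_derFam {n : ℕ} (hn : 3 ≤ n) (c : ℕ → ℝ) :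
    IsFundamentalOn (basisXY (derFam n c)) {x | coord x (2 * n) ≠ 0}
      ![fun x => I₂ n x / coord x (2 * n)] := by
  refine IsRegularInvariantOn.isFundamentalOn_der hn (Or.inr one_ne_zero) ?_
  have key := isRegularInvariantOn_mul_add (a := 0) (d := 1) (e := 0) (c := c) hn
    (S := {0}ᶜ) (f := fun z => z⁻¹) (f' := fun z => -(z ^ 2)⁻¹)
    (g := fun _ => 0) (g' := fun _ => 0) (U := {x | coord x (2 * n) ≠ 0}) (fun x hx => hx)
    (fun z hz => (contDiffAt_inv ℝ hz).contDiffWithinAt)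
    contDiffOn_const (fun z hz => hasDerivAt_inv hz)
    (fun z _ => hasDerivAt_const z 0) (fun z hz => ?_) (fun z _ => by ring)
    (fun z hz => mul_ne_zero (inv_ne_zero hz) hz)
  · simpa only [add_zero, div_eq_mul_inv] using key
  · have hz : z ≠ 0 := hz
    field_simp
    ring

/-! ## Derivations of `Q₂ₙ` -/

section Derivation

variable {n : ℕ}

lemma co_X_self {k : ℕ} (h1 : 1 ≤ k) (h2 : k ≤ 2 * n) : co (X n k) k = 1 := by
  rw [co_X _ _ h1 h2, if_pos rfl]

lemma co_X_of_ne {k m : ℕ} (h : m ≠ k) : co (X n k) m = 0 := by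
  by_cases hm : m ∈ Finset.Icc 1 (2 * n)
  · rw [co_X _ _ (Finset.mem_Icc.1 hm).1 (Finset.mem_Icc.1 hm).2, if_neg h]
  · rw [co, dif_neg hm]

lemma form_X_right (f : ℕ → ℝ) {k : ℕ} (h1 : 2 ≤ k) (h2 : k ≤ 2 * n - 1) :
    form n f (co (X n k)) = (-1) ^ (2 * n + 1 - k) * f (2 * n + 1 - k) := by
  rw [form, Finset.sum_eq_single_of_mem (2 * n + 1 - k) (by rw [Finset.mem_Icc]; omega)]
  · rw [co_X _ _ (by omega) (by omega), if_pos (by omega), mul_one]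
  · intro j hj hjk
    rw [Finset.mem_Icc] at hj
    rw [co_X _ _ (by omega) (by omega), if_neg (by omega), mul_zero]

lemma form_X_left (f : ℕ → ℝ) {k : ℕ} (h1 : 2 ≤ k) (h2 : k ≤ 2 * n - 1) :
    form n (co (X n k)) f = (-1) ^ k * f (2 * n + 1 - k) := by
  rw [form_comm, form_X_right f h1 h2,
    neg_one_pow_of_odd_add (i := 2 * n + 1 - k) (j := k) ⟨n, by omega⟩]
  ring

lemma form_X_one_left (f : ℕ → ℝ) : form n (co (X n 1)) f = 0 := by
  refine Finset.sum_eq_zero fun j hj => ?_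
  rw [Finset.mem_Icc] at hj
  rw [co_X _ _ (by omega) (by omega), if_neg (by omega)]
  ring

lemma lie_X_one_X {k : ℕ} (h1 : 2 ≤ k) (h2 : k ≤ 2 * n - 2) : ⁅X n 1, X n k⁆ = X n (k + 1) := by
  refine ext_co fun m hm1 hm2 => ?_
  rw [co_lie _ _ m hm1 hm2, co_X _ _ hm1 hm2, form_X_one_left]
  split_ifs <;> first
    | omega
    | rfl
    | (rw [co_X _ _ (by omega) (by omega), co_X _ _ (by omega) (by omega), if_pos (by omega),
        co_X _ _ (by omega) (by omega), co_X _ _ (by omega) (by omega)]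
       split_ifs <;> first | omega | norm_num)

lemma lie_X_one_X_last (hn : 2 ≤ n) : ⁅X n 1, X n (2 * n - 1)⁆ = 0 := by
  refine ext_co fun m hm1 hm2 => ?_
  rw [co_lie _ _ m hm1 hm2, co_zero, form_X_one_left]
  split_ifs <;> first
    | rfl
    | (rw [co_X _ _ (by omega) (by omega), co_X _ _ (by omega) (by omega), if_pos (by omega),
        co_X _ _ (by omega) (by omega), co_X _ _ (by omega) (by omega)]
       split_ifs <;> first | omega | norm_num)

lemma lie_X_two_X {k : ℕ} (h1 : 2 ≤ k) (h2 : k ≤ 2 * n - 2) : ⁅X n 2, X n k⁆ = 0 := by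
  refine ext_co fun m hm1 hm2 => ?_
  rw [co_lie _ _ m hm1 hm2, co_zero, form_X_left _ le_rfl (by omega),
    co_X_of_ne (k := 2) (m := 1) (by omega), co_X_of_ne (k := k) (m := 1) (by omega),
    co_X_of_ne (k := k) (m := 2 * n + 1 - 2) (by omega)]
  split_ifs <;> ring

lemma lie_X_two_X_last (hn : 2 ≤ n) : ⁅X n 2, X n (2 * n - 1)⁆ = X n (2 * n) := by
  refine ext_co fun m hm1 hm2 => ?_
  rw [co_lie _ _ m hm1 hm2, co_X _ m hm1 hm2, form_X_left _ le_rfl (by omega),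
    co_X_of_ne (k := 2) (m := 1) (by omega), co_X_of_ne (k := 2 * n - 1) (m := 1) (by omega),
    show 2 * n + 1 - 2 = 2 * n - 1 by omega, co_X_self (k := 2 * n - 1) (by omega) (by omega)]
  split_ifs <;> norm_num

lemma eq_sum_X (u : Q n) : u = ∑ k ∈ Finset.Icc 1 (2 * n), co u k • X n k := by
  have hsum : ∀ (s : Finset ℕ) (g : ℕ → Q n) (m : ℕ), co (∑ k ∈ s, g k) m = ∑ k ∈ s, co (g k) m :=
    fun s g m => map_sum (⟨⟨(co · m), co_zero m⟩, fun u v => co_add u v m⟩ : Q n →+ ℝ) g s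
  refine ext_co fun m h1 h2 => ?_
  rw [hsum, Finset.sum_eq_single_of_mem m (Finset.mem_Icc.2 ⟨h1, h2⟩)]
  · rw [co_smul, co_X _ _ h1 h2, if_pos rfl, mul_one]
  · intro k _ hk
    rw [co_smul, co_X _ _ h1 h2, if_neg (Ne.symm hk), mul_zero]

/-- A derivation which is normalized on the generators `X₁` and `X₂` vanishes. -/
lemma derivation_eq_zero (hn : 3 ≤ n) (E : LieDerivation ℝ (Q n) (Q n)) {β : ℝ}
    (h1 : E (X n 1) = β • X n 2) (h2 : co (E (X n 2)) 2 = 0)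
    (hodd : ∀ k, 1 ≤ k → k ≤ n - 1 → co (E (X n 2)) (2 * k + 1) = 0)
    (hlast : co (E (X n 2)) (2 * n) = 0) (u : Q n) : E u = 0 := by
  -- Applying `E` to `[X₁, X₂ₙ₋₁] = 0` leaves the term `β [X₂, X₂ₙ₋₁] = β X₂ₙ` in the last
  -- coordinate.
  have hβ : β = 0 := by
    have h := congrArg (co · (2 * n)) (E.apply_lie_eq_add (X n 1) (X n (2 * n - 1)))
    simp only [lie_X_one_X_last (by omega : 2 ≤ n), map_zero, co_zero, h1, smul_lie, co_add,
      co_smul, lie_X_two_X_last (by omega : 2 ≤ n)] at h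
    rw [co_lie _ _ _ (by omega) le_rfl, if_pos rfl, form_X_one_left,
      co_X _ _ (by omega) le_rfl, if_pos rfl] at h
    linarith
  have h1 : E (X n 1) = 0 := by rw [h1, hβ, zero_smul]
  have hstep : ∀ k, 2 ≤ k → k ≤ 2 * n - 2 → E (X n (k + 1)) = ⁅X n 1, E (X n k)⁆ :=
    fun k hk hk' => by
      rw [← lie_X_one_X hk hk', E.apply_lie_eq_add, h1, zero_lie, add_zero]
  have hco : ∀ k, 2 ≤ k → k ≤ 2 * n - 1 → ∀ m, k ≤ m → m ≤ 2 * n - 1 →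
      co (E (X n k)) m = co (E (X n 2)) (m - k + 2) := by
    intro k hk
    induction k, hk using Nat.le_induction with
    | base => exact fun _ m hm _ => by rw [Nat.sub_add_cancel hm]
    | succ k hk ih =>
      intro hk' m hm hm'
      rw [hstep k hk (by omega), co_lie _ _ m (by omega) (by omega), if_neg (by omega),
        if_pos (by omega), co_X _ _ le_rfl (by omega), if_pos rfl, co_X _ _ (by omega) (by omega),
        if_neg (by omega), ih (by omega) _ (by omega) (by omega),
        show m - 1 - k + 2 = m - (k + 1) + 2 by omega]
      ring
  -- This is the fourth coordinate of `E [X₂, X₃] = 0`; it is governed by the `X₁`-action because `4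
  -- < 2n`.
  have hone : co (E (X n 2)) 1 = 0 := by
    have h := congrArg (co · 4) (E.apply_lie_eq_add (X n 2) (X n 3))
    simp only [lie_X_two_X (by omega : 2 ≤ 3) (by omega : 3 ≤ 2 * n - 2), map_zero, co_zero, co_add,
      co_lie _ _ 4 (by omega) (by omega : 4 ≤ 2 * n)] at h
    rw [if_neg (by omega), if_pos (by omega), if_neg (by omega), if_pos (by omega),
      co_X _ _ le_rfl (by omega), co_X _ _ (by omega) (by omega), co_X _ _ (by omega) (by omega),
      co_X _ _ le_rfl (by omega)] at h
    norm_num at h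
    exact h.symm
  -- In the last coordinate of `E [X₂, Xₖ] = 0` the two Leibniz terms are equal for odd `k` and
  -- cancel for even `k`. Hence the even coordinates of `E X₂` are forced to vanish, while the odd
  -- ones are the free parameters `c`.
  have heven : ∀ k, 3 ≤ k → k ≤ 2 * n - 3 → Odd k → co (E (X n 2)) (2 * n + 1 - k) = 0 := by
    intro k hk hk' hkodd
    have h := congrArg (co · (2 * n)) (E.apply_lie_eq_add (X n 2) (X n k))
    simp only [lie_X_two_X (by omega : 2 ≤ k) (by omega : k ≤ 2 * n - 2), map_zero, co_zero, co_add,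
      co_lie _ _ (2 * n) (by omega) le_rfl, if_true] at h
    rw [form_X_left _ le_rfl (by omega), form_X_right _ (by omega) (by omega),
      hco k (by omega) (by omega) _ (by omega) (by omega),
      show 2 * n + 1 - 2 - k + 2 = 2 * n + 1 - k by omega,
      Even.neg_one_pow (n := 2 * n + 1 - k) ?_] at h
    · linarith
    · obtain ⟨j, rfl⟩ := hkodd
      exact ⟨n - j, by omega⟩
  have hX2 : E (X n 2) = 0 := by
    refine ext_co fun m hm1 hm2 => ?_
    rw [co_zero]
    rcases Nat.even_or_odd' m with ⟨j, rfl | rfl⟩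
    · rcases eq_or_ne j 1 with rfl | hj
      · exact h2
      rcases eq_or_ne j n with rfl | hj'
      · exact hlast
      have := heven (2 * n + 1 - 2 * j) (by omega) (by omega) ⟨n - j, by omega⟩
      rwa [show 2 * n + 1 - (2 * n + 1 - 2 * j) = 2 * j by omega] at this
    · rcases eq_or_ne j 0 with rfl | hj
      · exact hone
      · exact hodd j (by omega) (by omega)
  have hX : ∀ k, 2 ≤ k → k ≤ 2 * n - 1 → E (X n k) = 0 := by
    intro k hk
    induction k, hk using Nat.le_induction with
    | base => exact fun _ => hX2
    | succ k hk ih =>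
      intro hk'
      rw [hstep k hk (by omega), ih (by omega), lie_zero]
  rw [eq_sum_X u, map_sum]
  refine Finset.sum_eq_zero fun k hk => ?_
  rw [Finset.mem_Icc] at hk
  rw [map_smul]
  suffices h : E (X n k) = 0 by rw [h, smul_zero]
  rcases eq_or_ne k 1 with rfl | hk1
  · exact h1
  rcases eq_or_ne k (2 * n) with rfl | hk2
  · rw [← lie_X_two_X_last (by omega), E.apply_lie_eq_add, hX2, hX _ (by omega) le_rfl, lie_zero,
      zero_lie, add_zero]
  · exact hX k (by omega) (by omega)

/-- Every derivation of `Q₂ₙ` is the sum of an inner one and one of the form `der n a d e c`. -/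
theorem exists_derivation_eq (hn : 3 ≤ n) (D : LieDerivation ℝ (Q n) (Q n)) :
    ∃ (q : Q n) (a d e : ℝ) (c : ℕ → ℝ), ∀ u, D u = ⁅q, u⁆ + der n a d e c u := by
  -- `ad q` is chosen to match `D X₁` in coordinates `3, …, 2n-1` and `D X₂` in coordinates `3` and
  -- `2n`. The coordinate of `q` along the central `X₂ₙ` is immaterial.
  set q : Q n := ofCo fun j => if j = 1 then co (D (X n 2)) 3 else
    if j = 2 * n - 1 then -co (D (X n 2)) (2 * n) else -co (D (X n 1)) (j + 1) with hq
  have hq1 : co q 1 = co (D (X n 2)) 3 := by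
    rw [hq, co_ofCo _ _ le_rfl (by omega), if_pos rfl]
  have hq2 : co q (2 * n - 1) = -co (D (X n 2)) (2 * n) := by
    rw [hq, co_ofCo _ _ (by omega) (by omega), if_neg (by omega), if_pos rfl]
  have hq3 : ∀ j, 2 ≤ j → j ≤ 2 * n - 2 → co q j = -co (D (X n 1)) (j + 1) := fun j hj hj' => by
    rw [hq, co_ofCo _ _ (by omega) (by omega), if_neg (by omega), if_neg (by omega)]
  clear_value q
  set δ : LieDerivation ℝ (Q n) (Q n) := D - LieDerivation.ad ℝ (Q n) q with hδ
  have hδ' : ∀ u, δ u = D u - ⁅q, u⁆ := fun u => by simp [hδ]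
  have hδ1 : ∀ k, 3 ≤ k → k ≤ 2 * n - 1 → co (δ (X n 1)) k = 0 := fun k hk hk' => by
    rw [hδ', co_sub, co_lie _ _ _ (by omega) (by omega), if_neg (by omega), if_pos hk,
      hq3 (k - 1) (by omega) (by omega), co_X _ _ (by omega) (by omega), if_neg (by omega),
      co_X _ _ (by omega) (by omega), if_pos rfl, Nat.sub_add_cancel (by omega)]
    ring
  have hδ2 : co (δ (X n 2)) 3 = 0 := by
    rw [hδ', co_sub, co_lie _ _ _ (by omega) (by omega), if_neg (by omega), if_pos le_rfl, hq1,
      co_X _ _ (by omega) (by omega), if_pos rfl, co_X _ _ (by omega) (by omega),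
      if_neg (by omega)]
    ring
  have hδ3 : co (δ (X n 2)) (2 * n) = 0 := by
    rw [hδ', co_sub, co_lie _ _ _ (by omega) (by omega), if_pos rfl,
      form_X_right _ le_rfl (by omega), show 2 * n + 1 - 2 = 2 * n - 1 by omega, hq2,
      Odd.neg_one_pow ⟨n - 1, by omega⟩]
    ring
  set a := co (δ (X n 1)) 1
  set d := co (δ (X n 2)) 2
  set e := co (δ (X n 1)) (2 * n)
  set c : ℕ → ℝ := co (δ (X n 2))
  have hder : ∀ u, (δ - der n a d e c) u = δ u - derMap n a d e c u := fun u => rfl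
  have hX2 : ∀ m, 2 ≤ m → m ≤ 2 * n - 1 → co (derMap n a d e c (X n 2)) m =
      if m = 2 then d else if Odd m ∧ 5 ≤ m then c m else 0 := fun m hm hm' => by
    rw [co_derMap _ _ _ _ _ m (by omega) (by omega), if_neg (by omega), if_neg (by omega)]
    have hs : ∀ k, shift (2 * k - 1) (co (X n 2)) m =
        if 2 * k - 1 + 2 = m then 1 else 0 := fun k => by
      unfold shift
      split_ifs with h1 h2 h2
      · rw [show m - (2 * k - 1) = 2 by omega, co_X_self (by omega) (by omega)]
      · exact co_X_of_ne (by omega)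
      · omega
      · rfl
    simp only [hs, mul_ite, mul_one, mul_zero]
    by_cases h2 : m = 2
    · subst h2
      rw [if_pos rfl, co_X_self (by omega) (by omega), Finset.sum_eq_zero fun k hk => by
        rw [Finset.mem_Icc] at hk
        rw [if_neg (by omega)]]
      push_cast
      ring
    rw [if_neg h2, co_X_of_ne h2, mul_zero, zero_add]
    split_ifs with hodd
    · obtain ⟨⟨k, rfl⟩, hk⟩ := hodd
      rw [Finset.sum_eq_single_of_mem k (by rw [Finset.mem_Icc]; omega), if_pos (by omega)]
      intro j hj hjk
      rw [Finset.mem_Icc] at hj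
      rw [if_neg (by omega)]
    · refine Finset.sum_eq_zero fun k hk => ?_
      rw [Finset.mem_Icc] at hk
      rw [if_neg]
      exact fun h => hodd ⟨⟨k, by omega⟩, by omega⟩
  have hzero := derivation_eq_zero hn (δ - der n a d e c) (β := co (δ (X n 1)) 2)
    (ext_co fun m hm1 hm2 => by
      rw [hder, co_sub, co_derMap _ _ _ _ _ m hm1 hm2, co_smul, co_X_self le_rfl (by omega),
        co_X_of_ne (k := 1) (m := 2 * n) (by omega)]
      by_cases h1 : m = 1
      · rw [if_pos h1, co_X_of_ne (by omega), h1, mul_one, mul_zero, sub_self]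
      rw [if_neg h1]
      by_cases h2 : m = 2 * n
      · rw [if_pos h2, co_X_of_ne (by omega), h2, mul_one, mul_zero, mul_zero, zero_add, sub_self]
      have hs : ∑ k ∈ Finset.Icc 2 (n - 1), c (2 * k + 1) * shift (2 * k - 1) (co (X n 1)) m = 0 :=
        Finset.sum_eq_zero fun k hk => by
          unfold shift
          split_ifs
          · rw [co_X_of_ne (by omega), mul_zero]
          · rw [mul_zero]
      rw [if_neg h2, hs, co_X_of_ne h1]
      by_cases h3 : m = 2
      · rw [h3, co_X_self (by omega) (by omega)]; ring
      · rw [hδ1 m (by omega) (by omega), co_X_of_ne h3]; ring)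
    (by rw [hder, co_sub, hX2 2 le_rfl (by omega), if_pos rfl, sub_self])
    (fun k hk hk' => by
      rw [hder, co_sub, hX2 _ (by omega) (by omega), if_neg (by omega)]
      by_cases h : k = 1
      · rw [h, if_neg (by omega), sub_zero]; exact hδ2
      · rw [if_pos ⟨⟨k, rfl⟩, by omega⟩, sub_self])
    (by rw [hder, co_sub, co_derMap _ _ _ _ _ _ (by omega) le_rfl, if_neg (by omega), if_pos rfl,
          co_X_of_ne (k := 2) (m := 2 * n) (by omega), co_X_of_ne (k := 2) (m := 1) (by omega),
          mul_zero, mul_zero, add_zero, sub_zero]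
        exact hδ3)
  refine ⟨q, a, d, e, c, fun u => ?_⟩
  have h := hzero u
  rw [LieDerivation.sub_apply, hδ', sub_sub, sub_eq_zero] at h
  exact h

end Derivation

/-! ## Solvable Lie algebras with nilradical `Q₂ₙ` -/

lemma finrank_Q (n : ℕ) : Module.finrank ℝ (Q n) = 2 * n := by
  have h : Module.finrank ℝ (Idx n → ℝ) = 2 * n := by
    rw [Module.finrank_fintype_fun_eq_card, Fintype.card_coe, Nat.card_Icc, Nat.add_sub_cancel]
  exact h

lemma finrank_Ext {n : ℕ} (D : LieDerivation ℝ (Q n) (Q n)) :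
    Module.finrank ℝ (Ext D) = 2 * n + 1 := by
  rw [Module.finrank_eq_card_basis (basisXY D), Fintype.card_sum, Fintype.card_unit,
    Fintype.card_coe, Nat.card_Icc, Nat.add_sub_cancel]

lemma co_index_zero {n : ℕ} (u : Q n) : co u 0 = 0 := by
  rw [co, dif_neg (by simp)]

/-- The filtration of `Ext (der n 0 0 e c)` by the index of the first nonzero coordinate is strictly
increased by the adjoint action. -/
lemma lie_filtration {n : ℕ} {e : ℝ} {c : ℕ → ℝ} (u v : Ext (der n 0 0 e c)) {j : ℕ}
    (hs : v.snd = 0) (hv : ∀ m ≤ j, co v.fst m = 0) :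
    ∀ m ≤ j + 1, co (⁅u, v⁆ : Ext (der n 0 0 e c)).fst m = 0 := by
  intro m hm
  by_cases hm1 : 1 ≤ m
  swap
  · rw [show m = 0 by omega, co_index_zero]
  by_cases hm2 : m ≤ 2 * n
  swap
  · rw [co, dif_neg (by simp [hm2])]
  have hder : co (derMap n 0 0 e c v.fst) m = 0 := by
    rw [co_derMap _ _ _ _ _ m hm1 hm2]
    split_ifs with h1 h2
    · ring
    · rw [hv 1 (by omega)]; ring
    · rw [Finset.sum_eq_zero fun k hk => ?_]
      · ring
      · rw [Finset.mem_Icc] at hk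
        unfold shift
        split_ifs
        · rw [hv _ (by omega), mul_zero]
        · rw [mul_zero]
  have hlie : co ⁅u.fst, v.fst⁆ m = 0 := by
    rw [co_lie _ _ m hm1 hm2]
    split_ifs with h1 h2
    · refine Finset.sum_eq_zero fun i hi => ?_
      rw [Finset.mem_Icc] at hi
      rw [hv _ (by omega), mul_zero]
    · rw [hv _ (by omega), hv 1 (by omega)]; ring
    · rfl
  rw [Ext.fst_lie, hs, zero_smul, sub_zero, co_add, co_smul, hlie, zero_add]
  exact mul_eq_zero_of_right _ hder

/-- By Engel's theorem it suffices that each `ad u` is nilpotent. Its first application lands in `Q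
n`, and each of the next `2n` kills one more leading coordinate. -/
lemma isNilpotent_Ext {n : ℕ} (e : ℝ) (c : ℕ → ℝ) : LieRing.IsNilpotent (Ext (der n 0 0 e c)) := by
  have : Module.Finite ℝ (Ext (der n 0 0 e c)) := .of_basis (basisXY _)
  rw [LieAlgebra.isNilpotent_iff_forall (R := ℝ)]
  intro u
  have key : ∀ j v, ((LieAlgebra.ad ℝ _ u ^ (j + 1)) v).snd = 0 ∧
      ∀ m ≤ j, co ((LieAlgebra.ad ℝ _ u ^ (j + 1)) v).fst m = 0 := by
    intro j v
    induction j with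
    | zero =>
      refine ⟨by rw [zero_add, pow_one]; rfl, fun m hm => ?_⟩
      rw [Nat.le_zero.1 hm, co_index_zero]
    | succ j ih =>
      rw [pow_succ']
      exact ⟨rfl, lie_filtration u _ ih.1 ih.2⟩
  refine ⟨2 * n + 1, LinearMap.ext fun v => Ext.ext (ext_co fun m _ hm => ?_) (key (2 * n) v).1⟩
  rw [(key (2 * n) v).2 m hm]
  exact (co_zero m).symm

/-! ### Reduction of an abstract algebra to an extension of `Q n`. -/

section Nilradical

variable {n : ℕ} {L : Type*} [LieRing L] [LieAlgebra ℝ L] {N : LieIdeal ℝ L}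

/-- The derivation of `Q₂ₙ` induced by an element of a Lie algebra which contains `Q₂ₙ` as an
ideal. -/
def inducedDerivation (φ : N ≃ₗ⁅ℝ⁆ Q n) (y : L) : LieDerivation ℝ (Q n) (Q n) where
  toLinearMap := φ.toLinearEquiv.toLinearMap ∘ₗ LieModule.toEnd ℝ L N y ∘ₗ
    φ.symm.toLinearEquiv.toLinearMap
  leibniz' u v := by
    change φ ⁅y, φ.symm ⁅u, v⁆⁆ = ⁅u, φ ⁅y, φ.symm v⁆⁆ - ⁅v, φ ⁅y, φ.symm u⁆⁆
    have hinj : Function.Injective φ.symm := φ.symm.injective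
    refine hinj ?_
    rw [map_sub, LieEquiv.map_lie, LieEquiv.map_lie, LieEquiv.map_lie]
    simp only [LieEquiv.symm_apply_apply]
    generalize φ.symm u = u
    generalize φ.symm v = v
    ext
    change ⁅y, ⁅(u : L), (v : L)⁆⁆ = ⁅(u : L), ⁅y, (v : L)⁆⁆ - ⁅(v : L), ⁅y, (u : L)⁆⁆
    rw [leibniz_lie, ← lie_skew (v : L)]
    abel

lemma coe_symm_inducedDerivation (φ : N ≃ₗ⁅ℝ⁆ Q n) (y : L) (u : Q n) :
    (φ.symm (inducedDerivation φ y u) : L) = ⁅y, (φ.symm u : L)⁆ := by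
  change ((φ.symm (φ ⁅y, φ.symm u⁆) : N) : L) = _
  rw [LieEquiv.symm_apply_apply]
  rfl

theorem exists_lieEquiv_Ext (hn : 3 ≤ n) (hfin : Module.finrank ℝ L = 2 * n + 1)
    (hN : IsNilradical N) (φ : N ≃ₗ⁅ℝ⁆ Q n) :
    ∃ (a d e : ℝ) (c : ℕ → ℝ), (a ≠ 0 ∨ d ≠ 0) ∧ Nonempty (L ≃ₗ⁅ℝ⁆ Ext (der n a d e c)) := by
  have hfinite : Module.Finite ℝ L := Module.finite_of_finrank_pos (by omega)
  have hNfin : Module.finrank ℝ N = 2 * n := by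
    rw [φ.toLinearEquiv.finrank_eq, finrank_Q]
  have hNtop : N ≠ ⊤ := by
    rintro rfl
    have : Module.finrank ℝ (⊤ : Submodule ℝ L) = 2 * n := hNfin
    rw [finrank_top] at this
    omega
  obtain ⟨y₀, hy₀⟩ : ∃ y, y ∉ N := by
    by_contra! h
    exact hNtop (eq_top_iff.2 fun y _ => h y)
  obtain ⟨q, a, d, e, c, hD⟩ := exists_derivation_eq hn (inducedDerivation φ y₀)
  -- Subtracting the element of the nilradical behind the inner part leaves `y` acting exactly by
  -- `der n a d e c`.
  set y : L := y₀ - φ.symm q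
  have hy : y ∉ N := fun h => hy₀ (by simpa [y] using N.add_mem h (φ.symm q).2)
  have hNN : ∀ v w : N, ((⁅v, w⁆ : N) : L) = ⁅(v : L), (w : L)⁆ := fun _ _ => rfl
  have hlie : ∀ u : Q n, ⁅y, (φ.symm u : L)⁆ = φ.symm (der n a d e c u) := fun u => by
    have h1 := coe_symm_inducedDerivation φ y₀ u
    rw [hD, map_add, LieEquiv.map_lie, LieSubmodule.coe_add, hNN] at h1
    rw [sub_lie, ← h1]
    exact add_sub_cancel_left _ _
  let ψ : Ext (der n a d e c) →ₗ⁅ℝ⁆ L :=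
    { toFun := fun v => φ.symm v.fst + v.snd • y
      map_add' := fun v w => by
        rw [Ext.fst_add, Ext.snd_add, map_add, LieSubmodule.coe_add]; module
      map_smul' := fun t v => by
        rw [Ext.fst_smul, Ext.snd_smul, map_smul, LieSubmodule.coe_smul, RingHom.id_apply]; module
      map_lie' := fun {v w} => by
        change (φ.symm (⁅v, w⁆ : Ext (der n a d e c)).fst : L) +
          (⁅v, w⁆ : Ext (der n a d e c)).snd • y = ⁅_ + _, _ + _⁆
        rw [Ext.fst_lie, Ext.snd_lie]
        simp only [map_add, map_sub, map_smul, LieEquiv.map_lie, LieSubmodule.coe_add,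
          LieSubmodule.coe_sub, LieSubmodule.coe_smul, hNN, ← hlie, add_lie,
          lie_add, smul_lie, lie_smul, lie_self]
        rw [← lie_skew y (φ.symm v.fst : L)]
        module }
  have hinj : Function.Injective ψ := by
    refine (injective_iff_map_eq_zero ψ).2 fun v hv => ?_
    have hv : (φ.symm v.fst : L) + v.snd • y = 0 := hv
    have hs : v.snd = 0 := by
      by_contra h
      refine hy ?_
      have : v.snd • y ∈ N := by
        rw [eq_neg_of_add_eq_zero_right hv]
        exact N.neg_mem (φ.symm v.fst).2
      simpa [smul_smul, inv_mul_cancel₀ h] using N.smul_mem v.snd⁻¹ this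
    rw [hs, zero_smul, add_zero] at hv
    exact Ext.ext ((map_eq_zero_iff φ.symm φ.symm.injective).1 (Subtype.ext hv)) hs
  have hfinExt : Module.Finite ℝ (Ext (der n a d e c)) := .of_basis (basisXY _)
  have hsurj : Function.Surjective ψ := (LinearMap.injective_iff_surjective_of_finrank_eq_finrank
    (f := ψ.toLinearMap) (by rw [hfin, finrank_Ext])).1 hinj
  let ψ' : Ext (der n a d e c) ≃ₗ⁅ℝ⁆ L := LieEquiv.ofBijective ψ ⟨hinj, hsurj⟩
  refine ⟨a, d, e, c, ?_, ⟨ψ'.symm⟩⟩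
  -- If both weights vanish, the algebra itself is a nilpotent ideal, hence contained in its
  -- nilradical `N`, although `N` is proper.
  by_contra! h
  obtain ⟨rfl, rfl⟩ := h
  have hnil := isNilpotent_Ext (n := n) e c
  have hnilL : LieRing.IsNilpotent L := (LieEquiv.nilpotent_iff_equiv_nilpotent ψ').1 hnil
  have htop : LieRing.IsNilpotent (⊤ : LieIdeal ℝ L) :=
    Function.Injective.lieAlgebra_isNilpotent (f := (⊤ : LieIdeal ℝ L).incl)
      (fun _ _ h => Subtype.ext h)
  exact hNtop (top_le_iff.1 (hN.2 htop))

end Nilradical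

theorem hasExactlyInvariants_of_isNilradical {n : ℕ} (hn : 3 ≤ n) {L : Type*} [LieRing L]
    [LieAlgebra ℝ L] (hfin : Module.finrank ℝ L = 2 * n + 1) {N : LieIdeal ℝ L}
    (hN : IsNilradical N) (φ : N ≃ₗ⁅ℝ⁆ Q n) {ι : Type*} [Fintype ι] [DecidableEq ι]
    (b : Module.Basis ι ℝ L) : HasExactlyInvariants b 1 := by
  obtain ⟨a, d, e, c, had, ⟨ψ⟩⟩ := exists_lieEquiv_Ext hn hfin hN φ
  exact ((hasLocalInvariant_der hn had).of_lieEquiv ψ).hasExactlyInvariants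

end SolvableQ

theorem theorem1 (n : ℕ) (hn : 3 ≤ n) :
    (∀ (L : Type*) [LieRing L] [LieAlgebra ℝ L], LieAlgebra.IsSolvable L →
      Module.finrank ℝ L = 2 * n + 1 →
      (∃ N : LieIdeal ℝ L, SolvableQ.IsNilradical N ∧ Nonempty (N ≃ₗ⁅ℝ⁆ SolvableQ.Q n)) →
      ∀ (ι : Type*) [Fintype ι] [DecidableEq ι] (b : Module.Basis ι ℝ L),
        SolvableQ.HasExactlyInvariants b 1) ∧
    (∀ lam : ℝ,
      SolvableQ.HasExactlyInvariants (SolvableQ.basisXY (SolvableQ.derLam n lam)) 1 ∧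
      (2 * n - 3 + 2 * lam ≠ 0 →
        SolvableQ.IsFundamentalOn (SolvableQ.basisXY (SolvableQ.derLam n lam))
          {x | 0 < SolvableQ.coord x (2 * n)}
          ![fun x => SolvableQ.I₂ n x *
            SolvableQ.coord x (2 * n) ^ (-((2 * n - 2 + 2 * lam) / (2 * n - 3 + 2 * lam)))]) ∧
      (2 * n - 3 + 2 * lam = 0 →
        SolvableQ.IsFundamentalOn (SolvableQ.basisXY (SolvableQ.derLam n lam))
          Set.univ ![fun x => SolvableQ.coord x (2 * n)])) ∧
    (∀ ε : ℝ, (ε = -1 ∨ ε = 0 ∨ ε = 1) →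
      SolvableQ.HasExactlyInvariants (SolvableQ.basisXY (SolvableQ.derEps n ε)) 1 ∧
      SolvableQ.IsFundamentalOn (SolvableQ.basisXY (SolvableQ.derEps n ε))
        {x | 0 < SolvableQ.coord x (2 * n)}
        ![fun x => SolvableQ.I₂ n x / SolvableQ.coord x (2 * n) ^ 2 -
          ε * Real.log (SolvableQ.coord x (2 * n))]) ∧
    (∀ c : ℕ → ℝ,
      SolvableQ.HasExactlyInvariants (SolvableQ.basisXY (SolvableQ.derFam n c)) 1 ∧
      SolvableQ.IsFundamentalOn (SolvableQ.basisXY (SolvableQ.derFam n c))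
        {x | SolvableQ.coord x (2 * n) ≠ 0}
        ![fun x => SolvableQ.I₂ n x / SolvableQ.coord x (2 * n)]) := by
  refine ⟨fun L _ _ _ hfin ⟨N, hN, ⟨φ⟩⟩ ι _ _ b =>
      SolvableQ.hasExactlyInvariants_of_isNilradical hn hfin hN φ b,
    fun lam => ⟨?_, SolvableQ.isFundamentalOn_derLam hn, fun h => ?_⟩,
    fun ε _ => ⟨?_, SolvableQ.isFundamentalOn_derEps hn ε⟩,
    fun c => ⟨?_, SolvableQ.isFundamentalOn_derFam hn c⟩⟩
  · exact (SolvableQ.hasLocalInvariant_der hn (Or.inl one_ne_zero)).hasExactlyInvariants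
  · exact (SolvableQ.isRegularInvariantOn_coord hn (by linarith) _).isFundamentalOn_der hn
      (Or.inl one_ne_zero)
  · exact (SolvableQ.hasLocalInvariant_der hn (Or.inl one_ne_zero)).hasExactlyInvariants
  · exact (SolvableQ.hasLocalInvariant_der hn (Or.inr one_ne_zero)).hasExactlyInvariants
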